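/- Let $\Pi_1\subseteq\cdots\subseteq\Pi_s\subseteq\mathbb{C}^n$ be linear subspaces (equalities $\Pi_i=\Pi_{i+1}$ are allowed), put $l_i=\dim\Pi_i$, and let $0<k_1<\cdots<k_s$ be integers with $k_i\le l_i$ for all $i$. Let $$\mathrm{Fl}_{k_1,\dots,k_s}(\mathbb{C}^n,\Pi_\bullet)=\{\,V_1\subseteq\cdots\subseteq V_s\subseteq\mathbb{C}^n \;:\; \dim V_i=k_i \text{ and } V_i\subseteq\Pi_i \text{ for all } i\,\}$$ be the associated restrictive flag manifold, regarded as a subspace of projective space through the Plücker embedding $V_\bullet\mapsto[\wedge^{k_1}V_1\otimes\cdots\otimes\wedge^{k_s}V_s]$ of the flag manifold of $\mathbb{C}^n$. Then this map is injective on $\mathrm{Fl}_{k_1,\dots,k_s}(\mathbb{C}^n,\Pi_\bullet)$ and its image is exactly the set of complex points of a closed subvariety of projective space. With the reduced scheme structure, $\mathrm{Fl}_{k_1,\dots,k_s}(\mathbb{C}^n,\Pi_\bullet)$ is an integral projective variety that is connected (in the Zariski and in the classical topology) and smooth over $\mathbb{C}$ of dimension $$k_1(l_1-k_1)+(k_2-k_1)(l_2-k_2)+\cdots+(k_s-k_{s-1})(l_s-k_s).$$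 -/

import Mathlib

open AlgebraicGeometry
open scoped CategoryTheory LinearAlgebra.Projectivization

attribute [local instance] MvPolynomial.gradedAlgebra

noncomputable section

/-- A restrictive flag associated to `Π 1, …, Π s ⊆ ℂⁿ` and `k 1, …, k s`: a chain of subspaces
`V 1 ⊆ ⋯ ⊆ V s` of `ℂⁿ` with `dim (V i) = k i` and `V i ⊆ Π i`. -/
@[ext]
structure RestrictiveFlag {n s : ℕ} (k : Fin s → ℕ) (P : Fin s → Submodule ℂ (Fin n → ℂ)) where
  /-- the subspaces of the flag -/
  V : Fin s → Submodule ℂ (Fin n → ℂ)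
  mono : Monotone V
  finrank_eq : ∀ i, Module.finrank ℂ (V i) = k i
  le : ∀ i, V i ≤ P i

/-- The indices of the Plücker–Segre coordinates: one word `J i` of `k i` column indices for
each `i`. All words are used, not only the increasing ones; the coordinates at
the other words are `0` or `±` those at increasing words, so that this composes the usual
embedding with a linear embedding of projective spaces. -/
abbrev PluckerIndex (n : ℕ) {s : ℕ} (k : Fin s → ℕ) : Type :=
  (i : Fin s) → Fin (k i) → Fin n

/-- The Plücker–Segre coordinates of a tuple of frames `b i : Fin (k i) → ℂⁿ`: the products over
`i` of the `k i × k i` minors of the matrix whose rows are the vectors of the `i`-th frame. -/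
def pluckerVector {n s : ℕ} {k : Fin s → ℕ} (b : (i : Fin s) → Fin (k i) → Fin n → ℂ) :
    PluckerIndex n k → ℂ :=
  fun J ↦ ∏ i, (Matrix.of fun a c : Fin (k i) ↦ b i a (J i c)).det

/-- A linearly independent tuple has a nonzero maximal minor. -/
theorem exists_minor_ne_zero {m n : ℕ} (b : Fin m → Fin n → ℂ) (hb : LinearIndependent ℂ b) :
    ∃ J : Fin m → Fin n, (Matrix.of fun a c : Fin m ↦ b a (J c)).det ≠ 0 := by
  have hrank : (Matrix.of b).rank = m := by
    simpa using LinearIndependent.rank_matrix (M := Matrix.of b) hb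
  obtain ⟨κ, e, he, hspan, hli⟩ := exists_linearIndependent' ℂ (Matrix.of b).col
  have : Fintype κ := @Fintype.ofFinite κ (Finite.of_injective e he)
  have hcard : Fintype.card κ = m := by
    rw [← finrank_span_eq_card hli, hspan, ← Matrix.rank_eq_finrank_span_cols, hrank]
  let σ : Fin m ≃ κ := (Fintype.equivFinOfCardEq hcard).symm
  refine ⟨e ∘ σ, ?_⟩
  have hli' : LinearIndependent ℂ
      (Matrix.of fun a c : Fin m ↦ b a ((e ∘ σ) c)).col := hli.comp σ σ.injective
  rw [Matrix.linearIndependent_cols_iff_isUnit, Matrix.isUnit_iff_isUnit_det] at hli'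
  exact hli'.ne_zero

theorem pluckerVector_ne_zero {n s : ℕ} {k : Fin s → ℕ}
    (b : (i : Fin s) → Fin (k i) → Fin n → ℂ) (hb : ∀ i, LinearIndependent ℂ (b i)) :
    pluckerVector b ≠ 0 := by
  choose J hJ using fun i ↦ exists_minor_ne_zero (b i) (hb i)
  exact fun h ↦ Finset.prod_ne_zero_iff.2 (fun i _ ↦ hJ i) (congrFun h J)

namespace RestrictiveFlag

variable {n s : ℕ} {k : Fin s → ℕ} {P : Fin s → Submodule ℂ (Fin n → ℂ)}

/-- A choice of a basis of each subspace of the flag. -/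
def frame (F : RestrictiveFlag k P) (i : Fin s) (a : Fin (k i)) : Fin n → ℂ :=
  (Module.finBasisOfFinrankEq ℂ (F.V i) (F.finrank_eq i) a : F.V i)

theorem linearIndependent_frame (F : RestrictiveFlag k P) (i : Fin s) :
    LinearIndependent ℂ (F.frame i) :=
  (Module.finBasisOfFinrankEq ℂ (F.V i) (F.finrank_eq i)).linearIndependent.map'
    (F.V i).subtype (F.V i).ker_subtype

/-- The Plücker–Segre embedding. Another choice of bases multiplies
the coordinate vector by a nonzero scalar, so the point does not depend on it. -/
def plucker (F : RestrictiveFlag k P) : ℙ ℂ (PluckerIndex n k → ℂ) :=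
  Projectivization.mk ℂ (pluckerVector F.frame)
    (pluckerVector_ne_zero F.frame F.linearIndependent_frame)

end RestrictiveFlag

/-- The classical (Euclidean) topology on the complex points of a projective space: the quotient
topology of `ℂ^ι ∖ {0}`. -/
abbrev classicalTopology (ι : Type) : TopologicalSpace (ℙ ℂ (ι → ℂ)) :=
  TopologicalSpace.coinduced
    (fun v : {v : ι → ℂ // v ≠ 0} ↦ Projectivization.mk ℂ v.1 v.2) inferInstance

/-- The projective space `Proj ℂ[x_i : i ∈ ι]` as a scheme. -/
abbrev ProjSpace (ι : Type) : Scheme.{0} :=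
  Proj (MvPolynomial.homogeneousSubmodule ι ℂ)

/-- The structure morphism of projective space over `ℂ`. -/
def ProjSpace.toSpec (ι : Type) : ProjSpace ι ⟶ Spec (CommRingCat.of ℂ) :=
  Proj.toSpecZero (MvPolynomial.homogeneousSubmodule ι ℂ) ≫
    Spec.map (CommRingCat.ofHom (algebraMap ℂ (MvPolynomial.homogeneousSubmodule ι ℂ 0)))

/-- The point of the scheme `Proj ℂ[x_i : i ∈ ι]` given by a complex point of projective space:
the ideal generated by the homogeneous polynomials that vanish there. -/
def complexPoint {ι : Type} (p : ℙ ℂ (ι → ℂ)) : ProjSpace ι :=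
  show ProjectiveSpectrum (MvPolynomial.homogeneousSubmodule ι ℂ) from
  { asHomogeneousIdeal := (RingHom.ker (MvPolynomial.eval p.rep)).homogeneousCore
      (MvPolynomial.homogeneousSubmodule ι ℂ)
    isPrime := (RingHom.ker_isPrime (MvPolynomial.eval p.rep)).homogeneousCore
    not_irrelevant_le := by
      intro h
      obtain ⟨i, hi⟩ := Function.ne_iff.1 p.rep_nonzero
      have hX : (MvPolynomial.X i : MvPolynomial ι ℂ) ∈
          HomogeneousIdeal.irrelevant (MvPolynomial.homogeneousSubmodule ι ℂ) :=
        HomogeneousIdeal.mem_irrelevant_of_mem _ one_pos (MvPolynomial.isHomogeneous_X ℂ i)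
      have h' := Ideal.homogeneousCore'_le _ _ (h hX)
      rw [RingHom.mem_ker, MvPolynomial.eval_X] at h'
      exact hi h' }

/-- The Zariski closure, in projective space, of the set of restrictive flags. -/
def flagLocus {n s : ℕ} (k : Fin s → ℕ) (P : Fin s → Submodule ℂ (Fin n → ℂ)) :
    TopologicalSpace.Closeds (ProjSpace (PluckerIndex n k)) :=
  TopologicalSpace.Closeds.closure
    (Set.range fun F : RestrictiveFlag k P ↦ complexPoint F.plucker)

/-- The restrictive flag manifold as an algebraic variety: the
closed subset `flagLocus k P` of projective space with its reduced scheme structure. -/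
def restrictiveFlagManifold {n s : ℕ} (k : Fin s → ℕ) (P : Fin s → Submodule ℂ (Fin n → ℂ)) :
    Scheme.{0} :=
  (Scheme.IdealSheafData.vanishingIdeal (flagLocus k P)).subscheme

/-- The inclusion of the restrictive flag manifold into projective space. -/
def restrictiveFlagManifold.ι {n s : ℕ} (k : Fin s → ℕ)
    (P : Fin s → Submodule ℂ (Fin n → ℂ)) :
    restrictiveFlagManifold k P ⟶ ProjSpace (PluckerIndex n k) :=
  (Scheme.IdealSheafData.vanishingIdeal (flagLocus k P)).subschemeι

/-- `k (i - 1)`, with the convention that it is `0` for the first index `i`. -/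
def prevDim {s : ℕ} (k : Fin s → ℕ) (i : Fin s) : ℕ :=
  if 0 < i.1 then k ⟨i.1 - 1, lt_of_le_of_lt (Nat.sub_le _ _) i.2⟩ else 0

end

/-!
Write `ℓ i` for the dimension of `P i`. Flags are described by frames, and the Plücker–Segre
vector `z` of a tuple of frames determines the flag: if `z J ≠ 0`, the quotients of coordinates
collected in `reducedRow z J i` are, by Cramer's rule, the rows of the frame of the `i`-th subspace
that is the identity in the columns `J i`. This gives injectivity. It also shows that the flags are
all the complex points of their Zariski closure: the conditions that `z` is the vector of minors of
the reduced frames, that the reduced frames span a chain of subspaces and that the `i`-th one lies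
in `P i` become homogeneous equations in `z`, once they are multiplied by powers of `z J`
(`exists_flag_of_forall_eval_eq_zero`).

Given two flags, choose rows `f` and `g` whose first `k i` members span their `i`-th subspaces. The
rows `f + t (g - f)` remain in the subspaces `P i`, so they define flags for all but finitely many
`t ∈ ℂ`, and any two flags lie on a polynomial curve of flags
(`RestrictiveFlag.exists_curve`). Such a curve is irreducible, and connected in the classical
topology; hence the whole manifold is irreducible, and connected in both topologies.

Around a flag with adapted rows `f` there is an affine chart (`RestrictiveFlag.exists_chart`). Let
`e` be linear forms dual to `f`, and let `C i` be the subspace of `P i` where the first `k i` of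
them vanish, which has dimension `ℓ i - k i`. The flags on which the first `k i` forms `e` are
coordinates of the `i`-th subspace, for all `i`, are obtained exactly once by adding to each row
of `f` with index in `[k (i - 1), k i)` an element of `C i`. So they are parametrized by an affine
space of dimension `∑ (k i - k (i - 1)) (ℓ i - k i)`. They are also the flags at which a certain
linear form `l` in the Plücker–Segre coordinates does not vanish, and by Cramer's rule the
coordinates of the affine space are themselves linear forms in the Plücker–Segre coordinates
(normalized by `l = 1`). Hence the affine space is a closed subscheme of the open set where `l` does
not vanish, and since it is reduced and its complex points are those of the flag manifold, it
is the trace there of the closure with its reduced structure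
(`isStandardSmooth_of_affineSpace`). By the Nullstellensatz every point of the closure specializes
to a complex point, so these charts cover the scheme, which is therefore smooth of the stated
dimension. It is integral, being reduced and irreducible.
-/

/-! ### Plücker coordinates and frames -/

section Frames

variable {n s : ℕ} {k : Fin s → ℕ} {P : Fin s → Submodule ℂ (Fin n → ℂ)}

/-- The tuple of vectors whose rows are those of the matrix product `A * b`. -/
def changeFrame {m m' : ℕ} (A : Matrix (Fin m) (Fin m') ℂ) (b : Fin m' → Fin n → ℂ)
    (a : Fin m) : Fin n → ℂ :=
  ∑ j, A a j • b j

theorem changeFrame_apply {m m' : ℕ} (A : Matrix (Fin m) (Fin m') ℂ) (b : Fin m' → Fin n → ℂ)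
    (a : Fin m) (c : Fin n) : changeFrame A b a c = ∑ j, A a j * b j c := by
  simp [changeFrame]

theorem changeFrame_changeFrame {m m' m'' : ℕ} (A : Matrix (Fin m) (Fin m') ℂ)
    (A' : Matrix (Fin m') (Fin m'') ℂ) (b : Fin m'' → Fin n → ℂ) :
    changeFrame A (changeFrame A' b) = changeFrame (A * A') b := by
  ext a c
  simp only [changeFrame_apply, Matrix.mul_apply, Finset.sum_mul, Finset.mul_sum]
  rw [Finset.sum_comm]
  simp only [mul_assoc]

theorem span_changeFrame_le {m m' : ℕ} (A : Matrix (Fin m) (Fin m') ℂ)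
    (b : Fin m' → Fin n → ℂ) :
    Submodule.span ℂ (Set.range (changeFrame A b)) ≤ Submodule.span ℂ (Set.range b) := by
  rw [Submodule.span_le]
  rintro _ ⟨a, rfl⟩
  exact Submodule.sum_mem _ fun j _ ↦
    Submodule.smul_mem _ _ (Submodule.subset_span ⟨j, rfl⟩)

theorem span_changeFrame {m : ℕ} {A : Matrix (Fin m) (Fin m) ℂ} (hA : IsUnit A.det)
    (b : Fin m → Fin n → ℂ) :
    Submodule.span ℂ (Set.range (changeFrame A b)) = Submodule.span ℂ (Set.range b) := by
  refine le_antisymm (span_changeFrame_le A b) ?_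
  have h := span_changeFrame_le A⁻¹ (changeFrame A b)
  rw [changeFrame_changeFrame, Matrix.nonsing_inv_mul _ hA] at h
  have h1 : changeFrame (1 : Matrix (Fin m) (Fin m) ℂ) b = b := by
    ext a c
    simp [changeFrame_apply, Matrix.one_apply]
  rwa [h1] at h

theorem exists_eq_changeFrame {m m' : ℕ} {b : Fin m → Fin n → ℂ} {b' : Fin m' → Fin n → ℂ}
    (h : ∀ a, b a ∈ Submodule.span ℂ (Set.range b')) :
    ∃ A : Matrix (Fin m) (Fin m') ℂ, b = changeFrame A b' := by
  choose A hA using fun a ↦ (Submodule.mem_span_range_iff_exists_fun ℂ).1 (h a)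
  exact ⟨Matrix.of A, funext fun a ↦ (hA a).symm⟩

theorem det_minor_changeFrame {m : ℕ} (A : Matrix (Fin m) (Fin m) ℂ) (b : Fin m → Fin n → ℂ)
    (J : Fin m → Fin n) :
    (Matrix.of fun a c : Fin m ↦ changeFrame A b a (J c)).det =
      A.det * (Matrix.of fun a c : Fin m ↦ b a (J c)).det := by
  rw [← Matrix.det_mul]
  congr 1
  ext a c
  simp [changeFrame_apply, Matrix.mul_apply]

theorem linearIndependent_of_pluckerVector_ne_zero {b : (i : Fin s) → Fin (k i) → Fin n → ℂ}
    (h : pluckerVector b ≠ 0) (i : Fin s) : LinearIndependent ℂ (b i) := by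
  obtain ⟨J, hJ⟩ := Function.ne_iff.1 h
  have hJi := Finset.prod_ne_zero_iff.1 hJ i (Finset.mem_univ i)
  have := Matrix.linearIndependent_rows_of_det_ne_zero hJi
  exact LinearIndependent.of_comp (LinearMap.funLeft ℂ ℂ (J i)) this

/-- Changing the frames multiplies the Plücker–Segre vector by the product of the determinants of
the base changes. -/
theorem pluckerVector_changeFrame (A : (i : Fin s) → Matrix (Fin (k i)) (Fin (k i)) ℂ)
    (b : (i : Fin s) → Fin (k i) → Fin n → ℂ) :
    pluckerVector (fun i ↦ changeFrame (A i) (b i)) = (∏ i, (A i).det) • pluckerVector b := by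
  ext J
  simp only [pluckerVector, Pi.smul_apply, smul_eq_mul, ← Finset.prod_mul_distrib]
  exact Finset.prod_congr rfl fun i _ ↦ det_minor_changeFrame _ _ _

theorem RestrictiveFlag.span_frame (F : RestrictiveFlag k P) (i : Fin s) :
    Submodule.span ℂ (Set.range (F.frame i)) = F.V i := by
  have h : F.frame i =
      (F.V i).subtype ∘ Module.finBasisOfFinrankEq ℂ (F.V i) (F.finrank_eq i) := rfl
  rw [h, Set.range_comp, Submodule.span_image, Module.Basis.span_eq, Submodule.map_top,
    Submodule.range_subtype]

theorem RestrictiveFlag.plucker_eq_mk (F : RestrictiveFlag k P)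
    {b : (i : Fin s) → Fin (k i) → Fin n → ℂ}
    (hb : ∀ i, Submodule.span ℂ (Set.range (b i)) = F.V i) (h : pluckerVector b ≠ 0) :
    F.plucker = Projectivization.mk ℂ (pluckerVector b) h := by
  have key : ∀ i, ∃ A : Matrix (Fin (k i)) (Fin (k i)) ℂ,
      b i = changeFrame A (F.frame i) :=
    fun i ↦ exists_eq_changeFrame fun a ↦ by
      rw [F.span_frame i, ← hb i]
      exact Submodule.subset_span ⟨a, rfl⟩
  choose A hA using key
  have hbA : pluckerVector b = (∏ i, (A i).det) • pluckerVector F.frame := by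
    rw [← pluckerVector_changeFrame]
    congr 1
    exact funext hA
  refine ((Projectivization.mk_eq_mk_iff' ..).2 ⟨∏ i, (A i).det, hbA.symm⟩).symm

/-- Frames spanning a chain of subspaces inside the `P i` define a restrictive flag. -/
theorem exists_flag_of_frame (b : (i : Fin s) → Fin (k i) → Fin n → ℂ)
    (hmono : Monotone fun i ↦ Submodule.span ℂ (Set.range (b i)))
    (hP : ∀ i a, b i a ∈ P i) (h : pluckerVector b ≠ 0) :
    ∃ F : RestrictiveFlag k P, F.plucker = Projectivization.mk ℂ (pluckerVector b) h := by
  let F : RestrictiveFlag k P :=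
    { V := fun i ↦ Submodule.span ℂ (Set.range (b i))
      mono := hmono
      finrank_eq := fun i ↦ by
        rw [finrank_span_eq_card (linearIndependent_of_pluckerVector_ne_zero h i),
          Fintype.card_fin]
      le := fun i ↦ Submodule.span_le.2 (by rintro _ ⟨a, rfl⟩; exact hP i a) }
  exact ⟨F, F.plucker_eq_mk (fun i ↦ rfl) h⟩

/-- The rows of the reduced form, with respect to the columns `J i`, of a frame of the `i`-th
subspace, read off from the Plücker–Segre coordinates: by Cramer's rule the entry in row `a` and
column `c` is the quotient by `z J` of the coordinate where the letter `a` of the `i`-th word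
is replaced by `c`. -/
noncomputable def reducedRow (z : PluckerIndex n k → ℂ) (J : PluckerIndex n k) (i : Fin s) :
    Fin (k i) → Fin n → ℂ :=
  fun a c ↦ z (Function.update J i (Function.update (J i) a c)) / z J

theorem reducedRow_smul {t : ℂ} (ht : t ≠ 0) (z : PluckerIndex n k → ℂ) (J : PluckerIndex n k)
    (i : Fin s) : reducedRow (t • z) J i = reducedRow z J i := by
  ext a c
  simp only [reducedRow, Pi.smul_apply, smul_eq_mul]
  exact mul_div_mul_left _ _ ht

theorem isUnit_det_of_pluckerVector_ne_zero {b : (i : Fin s) → Fin (k i) → Fin n → ℂ}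
    {J : PluckerIndex n k} (hJ : pluckerVector b J ≠ 0) (i : Fin s) :
    IsUnit (Matrix.of fun a c : Fin (k i) ↦ b i a (J i c)).det :=
  (Finset.prod_ne_zero_iff.1 hJ i (Finset.mem_univ i)).isUnit

theorem reducedRow_pluckerVector {b : (i : Fin s) → Fin (k i) → Fin n → ℂ}
    {J : PluckerIndex n k} (hJ : pluckerVector b J ≠ 0) (i : Fin s) :
    reducedRow (pluckerVector b) J i =
      changeFrame (Matrix.of fun a c : Fin (k i) ↦ b i a (J i c))⁻¹ (b i) := by
  set M := Matrix.of fun a c : Fin (k i) ↦ b i a (J i c) with hM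
  have hMd : M.det ≠ 0 := (isUnit_det_of_pluckerVector_ne_zero hJ i).ne_zero
  ext a c
  have hcol : (Matrix.of fun a' c' : Fin (k i) ↦ b i a' (Function.update (J i) a c c')) =
      M.updateCol a fun a' ↦ b i a' c := by
    ext a' c'
    by_cases hc : c' = a
    · subst hc; simp
    · simp [hM, hc]
  have hnum : pluckerVector b (Function.update J i (Function.update (J i) a c)) * M.det =
      (M.updateCol a fun a' ↦ b i a' c).det * pluckerVector b J := by
    have e₁ : pluckerVector b J =
        M.det * ∏ j ∈ Finset.univ.erase i, (Matrix.of fun a c : Fin (k j) ↦ b j a (J j c)).det :=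
      (Finset.mul_prod_erase _ (fun j ↦ (Matrix.of fun a c : Fin (k j) ↦ b j a (J j c)).det)
        (Finset.mem_univ i)).symm
    have e₂ : pluckerVector b (Function.update J i (Function.update (J i) a c)) =
        (M.updateCol a fun a' ↦ b i a' c).det *
          ∏ j ∈ Finset.univ.erase i, (Matrix.of fun a c : Fin (k j) ↦ b j a (J j c)).det := by
      rw [← hcol]
      refine (Finset.mul_prod_erase _ _ (Finset.mem_univ i)).symm.trans ?_
      rw [Function.update_self]
      congr 1
      refine Finset.prod_congr rfl fun j hj ↦ ?_
      rw [Function.update_of_ne (Finset.ne_of_mem_erase hj)]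
    rw [e₁, e₂]
    ring
  have hlhs : reducedRow (pluckerVector b) J i a c =
      (M.updateCol a fun a' ↦ b i a' c).det / M.det := by
    simp only [reducedRow]
    rw [div_eq_div_iff hJ hMd, hnum]
  rw [hlhs, ← Matrix.cramer_apply, Matrix.cramer_eq_adjugate_mulVec, Matrix.inv_def,
    Ring.inverse_eq_inv', changeFrame_apply, div_eq_inv_mul, Matrix.mulVec, dotProduct,
    Finset.mul_sum]
  simp only [Matrix.smul_apply, smul_eq_mul, mul_assoc]

theorem span_reducedRow {b : (i : Fin s) → Fin (k i) → Fin n → ℂ}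
    {J : PluckerIndex n k} (hJ : pluckerVector b J ≠ 0) (i : Fin s) :
    Submodule.span ℂ (Set.range (reducedRow (pluckerVector b) J i)) =
      Submodule.span ℂ (Set.range (b i)) := by
  rw [reducedRow_pluckerVector hJ]
  exact span_changeFrame
    ((Matrix.isUnit_nonsing_inv_det_iff).2 (isUnit_det_of_pluckerVector_ne_zero hJ i)) _

theorem RestrictiveFlag.plucker_injective :
    Function.Injective (RestrictiveFlag.plucker (k := k) (P := P)) := by
  intro F G h
  obtain ⟨t, ht⟩ := (Projectivization.mk_eq_mk_iff' ..).1 h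
  have hne := pluckerVector_ne_zero F.frame F.linearIndependent_frame
  have ht0 : t ≠ 0 := by
    rintro rfl
    exact hne (by rw [← ht, zero_smul])
  obtain ⟨J, hJ⟩ := Function.ne_iff.1 hne
  have hJ' : pluckerVector G.frame J ≠ 0 := by
    intro h0
    apply hJ
    rw [← ht, Pi.smul_apply, h0, smul_zero, Pi.zero_apply]
  ext1
  funext i
  rw [← F.span_frame, ← G.span_frame, ← span_reducedRow hJ, ← span_reducedRow hJ', ← ht,
    reducedRow_smul ht0]

end Frames

/-! ### Adapted rows and lines of flags -/

section Rows

variable {n s : ℕ} {k : Fin s → ℕ} {P : Fin s → Submodule ℂ (Fin n → ℂ)}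

/-- The frames cut out of one sequence of rows: the `i`-th frame consists of the first `k i`
rows. -/
def rowFrame (k : Fin s → ℕ) (w : ℕ → Fin n → ℂ) (i : Fin s) (a : Fin (k i)) : Fin n → ℂ :=
  w a

theorem exists_adaptedRows_aux (hP : Monotone P) (hkP : ∀ i, k i ≤ Module.finrank ℂ (P i))
    (m : ℕ) (hm : m ≤ Finset.univ.sup k) :
    ∃ w : ℕ → Fin n → ℂ, LinearIndependent ℂ (fun a : Fin m ↦ w a) ∧
      ∀ j < m, ∀ i, j < k i → w j ∈ P i := by
  induction m with
  | zero => exact ⟨0, linearIndependent_empty_type, by simp⟩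
  | succ m ih =>
    obtain ⟨w, hw, hwP⟩ := ih (by omega)
    have hex : ∃ i : ℕ, ∃ h : i < s, m < k ⟨i, h⟩ := by
      obtain ⟨i, -, hi⟩ := (Finset.lt_sup_iff (a := m)).1 hm
      exact ⟨i, i.2, hi⟩
    classical
    obtain ⟨hi, hmi⟩ := Nat.find_spec hex
    set i₀ : Fin s := ⟨Nat.find hex, hi⟩
    have hnle : ¬ P i₀ ≤ Submodule.span ℂ (Set.range fun a : Fin m ↦ w a) := by
      intro hle
      have := Submodule.finrank_mono hle
      rw [finrank_span_eq_card hw, Fintype.card_fin] at this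
      have := hkP i₀
      omega
    obtain ⟨v, hv, hvs⟩ := SetLike.not_le_iff_exists.1 hnle
    refine ⟨Function.update w m v, ?_, ?_⟩
    · have he : (fun a : Fin (m + 1) ↦ Function.update w m v a) =
          Fin.snoc (α := fun _ ↦ Fin n → ℂ) (fun a : Fin m ↦ w a) v := by
        ext a : 1
        refine Fin.lastCases ?_ (fun a ↦ ?_) a
        · simp
        · simp [Function.update_of_ne a.2.ne]
      rw [he]
      exact linearIndependent_finSnoc.2 ⟨hw, hvs⟩
    · intro j hj i hji
      rcases (Nat.lt_succ_iff_lt_or_eq.1 hj) with hj | rfl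
      · rw [Function.update_of_ne hj.ne]
        exact hwP j hj i hji
      · rw [Function.update_self]
        exact hP (show i₀ ≤ i from Nat.find_min' hex ⟨i.2, hji⟩) hv

/-- If `k i ≤ dim (P i)` then the rows can be chosen one after the other, in `P i` up to the
`k i`-th one and linearly independent. -/
theorem exists_adaptedRows (hP : Monotone P) (hkP : ∀ i, k i ≤ Module.finrank ℂ (P i)) :
    ∃ w : ℕ → Fin n → ℂ, LinearIndependent ℂ (fun a : Fin (Finset.univ.sup k) ↦ w a) ∧
      ∀ i j, j < k i → w j ∈ P i := by
  obtain ⟨w, hw, hwP⟩ := exists_adaptedRows_aux hP hkP _ le_rfl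
  exact ⟨w, hw, fun i j hj ↦ hwP j (hj.trans_le (Finset.le_sup (Finset.mem_univ i))) i hj⟩

theorem linearIndependent_rowFrame {w : ℕ → Fin n → ℂ}
    (hw : LinearIndependent ℂ (fun a : Fin (Finset.univ.sup k) ↦ w a)) (i : Fin s) :
    LinearIndependent ℂ (rowFrame k w i) :=
  hw.comp (Fin.castLE (Finset.le_sup (Finset.mem_univ i)))
    (Fin.castLE_injective (Finset.le_sup (Finset.mem_univ i)))

theorem monotone_span_rowFrame (hk : Monotone k) (w : ℕ → Fin n → ℂ) :
    Monotone fun i ↦ Submodule.span ℂ (Set.range (rowFrame k w i)) := by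
  intro i j hij
  refine Submodule.span_mono ?_
  rintro _ ⟨a, rfl⟩
  exact ⟨Fin.castLE (hk hij) a, rfl⟩

theorem exists_flag_of_rows (hk : Monotone k) {w : ℕ → Fin n → ℂ}
    (hP : ∀ i j, j < k i → w j ∈ P i) (h : pluckerVector (rowFrame k w) ≠ 0) :
    ∃ F : RestrictiveFlag k P,
      F.plucker = Projectivization.mk ℂ (pluckerVector (rowFrame k w)) h :=
  exists_flag_of_frame _ (monotone_span_rowFrame hk w) (fun i a ↦ hP i a a.2) h

theorem nonempty_restrictiveFlag (hk : Monotone k) (hP : Monotone P)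
    (hkP : ∀ i, k i ≤ Module.finrank ℂ (P i)) : Nonempty (RestrictiveFlag k P) := by
  obtain ⟨w, hw, hwP⟩ := exists_adaptedRows hP hkP
  obtain ⟨F, -⟩ := exists_flag_of_rows hk hwP
    (pluckerVector_ne_zero _ fun i ↦ linearIndependent_rowFrame hw i)
  exact ⟨F⟩

/-- Rows adapted to a flag: the first `k i` of them form a basis of the `i`-th subspace. -/
theorem RestrictiveFlag.exists_rows (F : RestrictiveFlag k P) :
    ∃ w : ℕ → Fin n → ℂ, LinearIndependent ℂ (fun a : Fin (Finset.univ.sup k) ↦ w a) ∧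
      ∀ i, Submodule.span ℂ (Set.range (rowFrame k w i)) = F.V i := by
  obtain ⟨w, hw, hwV⟩ := exists_adaptedRows (P := F.V) F.mono fun i ↦ (F.finrank_eq i).ge
  refine ⟨w, hw, fun i ↦ Submodule.eq_of_le_of_finrank_eq ?_ ?_⟩
  · rw [Submodule.span_le]
    rintro _ ⟨a, rfl⟩
    exact hwV i a a.2
  · rw [finrank_span_eq_card (linearIndependent_rowFrame hw i), Fintype.card_fin, F.finrank_eq]

/-- Two flags are joined by a polynomial curve: interpolate linearly between rows adapted to
them. -/
theorem RestrictiveFlag.exists_curve (hk : Monotone k) (F G : RestrictiveFlag k P) :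
    ∃ γ : PluckerIndex n k → Polynomial ℂ,
      (∃ h, F.plucker = Projectivization.mk ℂ (fun J ↦ (γ J).eval 0) h) ∧
      (∃ h, G.plucker = Projectivization.mk ℂ (fun J ↦ (γ J).eval 1) h) ∧
      ∀ t, ∀ h : (fun J ↦ (γ J).eval t) ≠ 0,
        ∃ H : RestrictiveFlag k P, H.plucker = Projectivization.mk ℂ (fun J ↦ (γ J).eval t) h := by
  obtain ⟨f, hf, hfF⟩ := F.exists_rows
  obtain ⟨g, hg, hgG⟩ := G.exists_rows
  let w : ℂ → ℕ → Fin n → ℂ := fun t j ↦ f j + t • (g j - f j)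
  let γ : PluckerIndex n k → Polynomial ℂ := fun J ↦ ∏ i, (Matrix.of fun a c : Fin (k i) ↦
    (Polynomial.C (f a (J i c)) + Polynomial.X * Polynomial.C (g a (J i c) - f a (J i c)))).det
  have hγ : ∀ t, (fun J ↦ (γ J).eval t) = pluckerVector (rowFrame k (w t)) := by
    intro t
    ext J
    simp only [γ, pluckerVector, Polynomial.eval_prod]
    refine Finset.prod_congr rfl fun i _ ↦ ?_
    rw [← Polynomial.coe_evalRingHom, RingHom.map_det]
    congr 1
    ext a c
    simp [w, rowFrame]
  have h0 : w 0 = f := by ext; simp [w]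
  have h1 : w 1 = g := by ext; simp [w]
  have hfP : ∀ i j, j < k i → f j ∈ P i := fun i j hj ↦
    F.le i (hfF i ▸ Submodule.subset_span ⟨⟨j, hj⟩, rfl⟩)
  have hgP : ∀ i j, j < k i → g j ∈ P i := fun i j hj ↦
    G.le i (hgG i ▸ Submodule.subset_span ⟨⟨j, hj⟩, rfl⟩)
  have hfne : pluckerVector (rowFrame k f) ≠ 0 :=
    pluckerVector_ne_zero _ fun i ↦ linearIndependent_rowFrame (w := f) hf i
  have hgne : pluckerVector (rowFrame k g) ≠ 0 :=
    pluckerVector_ne_zero _ fun i ↦ linearIndependent_rowFrame (w := g) hg i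
  refine ⟨γ, ?_, ?_, ?_⟩
  · simp only [hγ, h0]
    exact ⟨hfne, F.plucker_eq_mk hfF hfne⟩
  · simp only [hγ, h1]
    exact ⟨hgne, G.plucker_eq_mk hgG hgne⟩
  · intro t
    simp only [hγ]
    exact fun h ↦ exists_flag_of_rows hk (fun i j hj ↦ Submodule.add_mem _ (hfP i j hj)
      (Submodule.smul_mem _ _ (Submodule.sub_mem _ (hgP i j hj) (hfP i j hj)))) h

end Rows

/-! ### Equations of the restrictive flags -/

section Equations

open MvPolynomial

variable {n s : ℕ} {k : Fin s → ℕ} {P : Fin s → Submodule ℂ (Fin n → ℂ)}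

theorem reducedRow_pluckerVector_apply_self {b : (i : Fin s) → Fin (k i) → Fin n → ℂ}
    {J : PluckerIndex n k} (hJ : pluckerVector b J ≠ 0) (i : Fin s) (a c : Fin (k i)) :
    reducedRow (pluckerVector b) J i a (J i c) = (1 : Matrix (Fin (k i)) (Fin (k i)) ℂ) a c := by
  rw [reducedRow_pluckerVector hJ, changeFrame_apply,
    ← Matrix.nonsing_inv_mul _ (isUnit_det_of_pluckerVector_ne_zero hJ i), Matrix.mul_apply]
  simp only [Matrix.of_apply]

theorem pluckerVector_reducedRow {b : (i : Fin s) → Fin (k i) → Fin n → ℂ}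
    {J : PluckerIndex n k} (hJ : pluckerVector b J ≠ 0) :
    pluckerVector (reducedRow (pluckerVector b) J) =
      (pluckerVector b J)⁻¹ • pluckerVector b := by
  have h : reducedRow (pluckerVector b) J = fun i ↦
      changeFrame (Matrix.of fun a c : Fin (k i) ↦ b i a (J i c))⁻¹ (b i) :=
    funext fun i ↦ reducedRow_pluckerVector hJ i
  rw [h, pluckerVector_changeFrame]
  congr 1
  simp only [Matrix.det_nonsing_inv, Ring.inverse_eq_inv', Finset.prod_inv_distrib]
  rfl

theorem isHomogeneous_det_X {σ ι : Type*} [Fintype ι] [DecidableEq ι] (f : ι → ι → σ) :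
    (Matrix.of fun a c ↦ (X (f a c) : MvPolynomial σ ℂ)).det.IsHomogeneous
      (Fintype.card ι) := by
  rw [Matrix.det_apply]
  refine IsHomogeneous.sum _ _ _ fun τ _ ↦ ?_
  have h : (∏ a, Matrix.of (fun a c ↦ (X (f a c) : MvPolynomial σ ℂ)) (τ a) a).IsHomogeneous
      (∑ _a : ι, 1) := IsHomogeneous.prod _ _ _ fun a _ ↦ isHomogeneous_X ℂ _
  rw [Finset.sum_const, Finset.card_univ, smul_eq_mul, mul_one] at h
  rcases Int.units_eq_one_or (Equiv.Perm.sign τ) with hs | hs <;> rw [hs]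
  · simpa using h
  · rw [Units.neg_smul, one_smul]
    exact (homogeneousSubmodule σ ℂ _).neg_mem h

/-- The index of the coordinate that is the entry in row `a` and column `c` of the `i`-th
reduced frame, up to the factor `z J`. -/
abbrev replaceLetter (J : PluckerIndex n k) (i : Fin s) (a : Fin (k i)) (c : Fin n) :
    PluckerIndex n k :=
  Function.update J i (Function.update (J i) a c)

theorem eq_mul_reducedRow {z : PluckerIndex n k → ℂ} {J : PluckerIndex n k} (hJ : z J ≠ 0)
    (i : Fin s) (a : Fin (k i)) (c : Fin n) :
    z (replaceLetter J i a c) = z J * reducedRow z J i a c := by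
  simp only [reducedRow]
  field_simp

/-- The equation saying that the `K`-th coordinate is the product of minors of the reduced
frames. -/
noncomputable def minorEquation (J K : PluckerIndex n k) : MvPolynomial (PluckerIndex n k) ℂ :=
  X J * (X K * X J ^ (∑ i, k i) -
    X J * ∏ i, (Matrix.of fun a c : Fin (k i) ↦ X (replaceLetter J i a (K i c))).det)

/-- The equation saying that the entry in row `a` and column `c` of the `i`-th reduced frame is
that of a linear combination of the rows of the `j`-th one. -/
noncomputable def incidenceEquation (J : PluckerIndex n k) (i j : Fin s) (a : Fin (k i))
    (c : Fin n) : MvPolynomial (PluckerIndex n k) ℂ :=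
  X J * (X J * X (replaceLetter J i a c) -
    ∑ b, X (replaceLetter J i a (J j b)) * X (replaceLetter J j b c))

/-- The equation saying that a linear form vanishes on row `a` of the `i`-th reduced frame. -/
noncomputable def linearEquation (J : PluckerIndex n k) (i : Fin s) (a : Fin (k i))
    (l : Module.Dual ℂ (Fin n → ℂ)) : MvPolynomial (PluckerIndex n k) ℂ :=
  X J * ∑ c, C (l (Pi.single c 1)) * X (replaceLetter J i a c)

theorem isHomogeneous_minorEquation (J K : PluckerIndex n k) :
    (minorEquation J K).IsHomogeneous (1 + (1 + ∑ i, k i)) := by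
  have h₁ := (isHomogeneous_X ℂ K).mul ((isHomogeneous_X ℂ J).pow (∑ i, k i))
  have h₂ := (isHomogeneous_X ℂ J).mul (IsHomogeneous.prod Finset.univ _ _ fun i _ ↦
    isHomogeneous_det_X fun a c : Fin (k i) ↦ replaceLetter J i a (K i c))
  simp only [Fintype.card_fin] at h₂
  rw [one_mul] at h₁
  exact (isHomogeneous_X ℂ J).mul (h₁.sub h₂)

theorem isHomogeneous_incidenceEquation (J : PluckerIndex n k) (i j : Fin s) (a : Fin (k i))
    (c : Fin n) : (incidenceEquation J i j a c).IsHomogeneous (1 + (1 + 1)) :=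
  (isHomogeneous_X ℂ J).mul (((isHomogeneous_X ℂ J).mul (isHomogeneous_X ℂ _)).sub
    (IsHomogeneous.sum _ _ _ fun _ _ ↦ (isHomogeneous_X ℂ _).mul (isHomogeneous_X ℂ _)))

theorem isHomogeneous_linearEquation (J : PluckerIndex n k) (i : Fin s) (a : Fin (k i))
    (l : Module.Dual ℂ (Fin n → ℂ)) : (linearEquation J i a l).IsHomogeneous (1 + 1) := by
  refine (isHomogeneous_X ℂ J).mul (IsHomogeneous.sum _ _ _ fun _ _ ↦ ?_)
  exact (isHomogeneous_X ℂ _).C_mul _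

theorem eval_minorEquation_eq_zero_iff {z : PluckerIndex n k → ℂ} {J : PluckerIndex n k}
    (hJ : z J ≠ 0) (K : PluckerIndex n k) :
    eval z (minorEquation J K) = 0 ↔ z K = z J * pluckerVector (reducedRow z J) K := by
  have hdet : ∀ i, eval z (Matrix.of fun a c : Fin (k i) ↦
      (X (replaceLetter J i a (K i c)) : MvPolynomial (PluckerIndex n k) ℂ)).det =
      z J ^ k i * (Matrix.of fun a c : Fin (k i) ↦ reducedRow z J i a (K i c)).det := by
    intro i
    have h := Matrix.det_smul
      (Matrix.of fun a c : Fin (k i) ↦ reducedRow z J i a (K i c)) (z J)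
    rw [Fintype.card_fin] at h
    rw [← h, RingHom.map_det]
    congr 1
    ext a c
    simp [← eq_mul_reducedRow hJ]
  have hev : eval z (minorEquation J K) =
      z J ^ (1 + ∑ i, k i) * (z K - z J * pluckerVector (reducedRow z J) K) := by
    simp only [minorEquation, map_mul, map_sub, map_pow, eval_X, map_prod, hdet,
      Finset.prod_mul_distrib, Finset.prod_pow_eq_pow_sum, pluckerVector]
    ring
  rw [hev, mul_eq_zero, or_iff_right (pow_ne_zero _ hJ), sub_eq_zero]

theorem eval_incidenceEquation_eq_zero_iff {z : PluckerIndex n k → ℂ} {J : PluckerIndex n k}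
    (hJ : z J ≠ 0) (i j : Fin s) (a : Fin (k i)) (c : Fin n) :
    eval z (incidenceEquation J i j a c) = 0 ↔
      reducedRow z J i a c = ∑ b, reducedRow z J i a (J j b) * reducedRow z J j b c := by
  have hev : eval z (incidenceEquation J i j a c) = z J ^ 3 * (reducedRow z J i a c -
      ∑ b, reducedRow z J i a (J j b) * reducedRow z J j b c) := by
    simp only [incidenceEquation, map_mul, map_sub, eval_X, map_sum, eq_mul_reducedRow hJ,
      mul_sub, Finset.mul_sum]
    congr 1
    · ring
    · exact Finset.sum_congr rfl fun b _ ↦ by ring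
  rw [hev, mul_eq_zero, or_iff_right (pow_ne_zero _ hJ), sub_eq_zero]

theorem eval_linearEquation_eq_zero_iff {z : PluckerIndex n k → ℂ} {J : PluckerIndex n k}
    (hJ : z J ≠ 0) (i : Fin s) (a : Fin (k i)) (l : Module.Dual ℂ (Fin n → ℂ)) :
    eval z (linearEquation J i a l) = 0 ↔ l (reducedRow z J i a) = 0 := by
  have hev : eval z (linearEquation J i a l) = z J ^ 2 * l (reducedRow z J i a) := by
    rw [LinearMap.pi_apply_eq_sum_univ l (reducedRow z J i a)]
    simp only [linearEquation, map_mul, eval_X, map_sum, eval_C, eq_mul_reducedRow hJ,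
      Finset.mul_sum, smul_eq_mul]
    refine Finset.sum_congr rfl fun c _ ↦ ?_
    have : (Pi.single c 1 : Fin n → ℂ) = fun j ↦ if c = j then 1 else 0 := by
      ext j
      simp [Pi.single_apply, eq_comm]
    rw [this]
    ring
  rw [hev, mul_eq_zero, or_iff_right (pow_ne_zero _ hJ)]

/-- The restrictive flags form a Zariski closed set of complex points: a point at which all
homogeneous polynomials vanishing on them vanish is a restrictive flag. -/
theorem exists_flag_of_forall_eval_eq_zero {z : PluckerIndex n k → ℂ} (hz : z ≠ 0)
    (h : ∀ d, ∀ f : MvPolynomial (PluckerIndex n k) ℂ, f.IsHomogeneous d →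
      (∀ F : RestrictiveFlag k P, eval (pluckerVector F.frame) f = 0) → eval z f = 0) :
    ∃ F : RestrictiveFlag k P, F.plucker = Projectivization.mk ℂ z hz := by
  obtain ⟨J, hJ⟩ := Function.ne_iff.1 hz
  replace hJ : z J ≠ 0 := hJ
  -- The factor `X J` makes each equation hold where the `J`-th coordinate vanishes.
  have hminor : ∀ K, z K = z J * pluckerVector (reducedRow z J) K := by
    intro K
    rw [← eval_minorEquation_eq_zero_iff hJ]
    refine h _ _ (isHomogeneous_minorEquation J K) fun F ↦ ?_
    by_cases hFJ : pluckerVector F.frame J = 0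
    · simp [minorEquation, hFJ]
    · rw [eval_minorEquation_eq_zero_iff hFJ, pluckerVector_reducedRow hFJ, Pi.smul_apply,
        smul_eq_mul, mul_inv_cancel_left₀ hFJ]
  have hincidence : ∀ i j, i ≤ j → ∀ a c, reducedRow z J i a c =
      ∑ b, reducedRow z J i a (J j b) * reducedRow z J j b c := by
    intro i j hij a c
    rw [← eval_incidenceEquation_eq_zero_iff hJ]
    refine h _ _ (isHomogeneous_incidenceEquation J i j a c) fun F ↦ ?_
    by_cases hFJ : pluckerVector F.frame J = 0
    · simp [incidenceEquation, hFJ]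
    rw [eval_incidenceEquation_eq_zero_iff hFJ]
    have hmem : reducedRow (pluckerVector F.frame) J i a ∈
        Submodule.span ℂ (Set.range (reducedRow (pluckerVector F.frame) J j)) := by
      rw [span_reducedRow hFJ, F.span_frame]
      apply F.mono hij
      rw [← F.span_frame, ← span_reducedRow hFJ]
      exact Submodule.subset_span ⟨a, rfl⟩
    obtain ⟨m, hm⟩ := (Submodule.mem_span_range_iff_exists_fun ℂ).1 hmem
    have hm' : ∀ c, reducedRow (pluckerVector F.frame) J i a c =
        ∑ b, m b * reducedRow (pluckerVector F.frame) J j b c := by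
      intro c
      rw [← hm]
      simp
    rw [hm' c]
    refine Finset.sum_congr rfl fun b _ ↦ ?_
    rw [hm' (J j b)]
    simp [reducedRow_pluckerVector_apply_self hFJ, Matrix.one_apply]
  have hlinear : ∀ i a, reducedRow z J i a ∈ P i := by
    intro i a
    rw [← Subspace.forall_mem_dualAnnihilator_apply_eq_zero_iff]
    intro l hl
    rw [← eval_linearEquation_eq_zero_iff hJ]
    refine h _ _ (isHomogeneous_linearEquation J i a l) fun F ↦ ?_
    by_cases hFJ : pluckerVector F.frame J = 0
    · simp [linearEquation, hFJ]
    rw [eval_linearEquation_eq_zero_iff hFJ]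
    refine (Submodule.mem_dualAnnihilator l).1 hl _ (F.le i ?_)
    rw [← F.span_frame, ← span_reducedRow hFJ]
    exact Submodule.subset_span ⟨a, rfl⟩
  have hsmul : z = z J • pluckerVector (reducedRow z J) := funext hminor
  have hne : pluckerVector (reducedRow z J) ≠ 0 := by
    intro h0
    rw [h0, smul_zero] at hsmul
    exact hz hsmul
  obtain ⟨F, hF⟩ := exists_flag_of_frame (P := P) (reducedRow z J) (fun i j hij ↦ by
    rw [Submodule.span_le]
    rintro _ ⟨a, rfl⟩
    have he : reducedRow z J i a = ∑ b, reducedRow z J i a (J j b) • reducedRow z J j b := by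
      ext c
      rw [hincidence i j hij a c]
      simp
    rw [he]
    exact Submodule.sum_mem _ fun b _ ↦
      Submodule.smul_mem _ _ (Submodule.subset_span ⟨b, rfl⟩)) hlinear hne
  exact ⟨F, hF.trans ((Projectivization.mk_eq_mk_iff' ..).2
    ⟨(z J)⁻¹, ((eq_inv_smul_iff₀ hJ).2 hsmul.symm).symm⟩)⟩

end Equations

/-! ### Affine charts -/

section Charts

open MvPolynomial

variable {n s : ℕ} {k : Fin s → ℕ} {P : Fin s → Submodule ℂ (Fin n → ℂ)}

/-- Cauchy–Binet expansion over all words: a minor formed with arbitrary linear forms instead of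
coordinates is a linear combination of the coordinate minors. -/
theorem det_dual_eq_sum {m : ℕ} (u : Fin m → Module.Dual ℂ (Fin n → ℂ))
    (b : Fin m → Fin n → ℂ) :
    (Matrix.of fun a c : Fin m ↦ u c (b a)).det =
      ∑ J : Fin m → Fin n, (∏ c, u c (Pi.single (J c) 1)) *
        (Matrix.of fun a c : Fin m ↦ b a (J c)).det := by
  have hu : ∀ a c, u c (b a) = ∑ j, u c (Pi.single j 1) * b a j := by
    intro a c
    have h : ∀ j : Fin n, (fun x ↦ if j = x then (1 : ℂ) else 0) = Pi.single j 1 := by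
      intro j
      ext x
      simp [Pi.single_apply, eq_comm]
    rw [LinearMap.pi_apply_eq_sum_univ (u c) (b a)]
    simp only [h, smul_eq_mul, mul_comm]
  have hrow : (Matrix.of fun a c : Fin m ↦ u c (b a)).det =
      Matrix.detRowAlternating.toMultilinearMap fun c ↦
        ∑ j, u c (Pi.single j 1) • fun a ↦ b a j := by
    rw [← Matrix.det_transpose]
    change Matrix.detRowAlternating.toMultilinearMap _ = _
    congr 1
    ext c a
    simp [hu]
  rw [hrow, MultilinearMap.map_sum]
  refine Finset.sum_congr rfl fun J _ ↦ ?_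
  rw [MultilinearMap.map_smul_univ, smul_eq_mul, ← Matrix.det_transpose]
  rfl

/-- The coefficients that express a product of minors formed with linear forms in terms of the
Plücker–Segre coordinates. -/
noncomputable def dualCoeff (u : (i : Fin s) → Fin (k i) → Module.Dual ℂ (Fin n → ℂ))
    (J : PluckerIndex n k) : ℂ :=
  ∏ i, ∏ c, u i c (Pi.single (J i c) 1)

theorem prod_det_dual_eq_sum (u : (i : Fin s) → Fin (k i) → Module.Dual ℂ (Fin n → ℂ))
    (b : (i : Fin s) → Fin (k i) → Fin n → ℂ) :
    ∏ i, (Matrix.of fun a c : Fin (k i) ↦ u i c (b i a)).det =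
      ∑ J, dualCoeff u J * pluckerVector b J := by
  simp only [det_dual_eq_sum, Finset.prod_univ_sum, Fintype.piFinset_univ, dualCoeff,
    pluckerVector, Finset.prod_mul_distrib]

/-- Every linearly independent finite family has a dual family of linear forms. -/
theorem LinearIndependent.exists_dual {V : Type*} [AddCommGroup V] [Module ℂ V] {m : ℕ}
    {v : Fin m → V} (hv : LinearIndependent ℂ v) :
    ∃ e : Fin m → Module.Dual ℂ V, ∀ b a, e b (v a) = if a = b then 1 else 0 := by
  obtain ⟨g, hg⟩ := LinearMap.exists_leftInverse_of_injective (Fintype.linearCombination ℂ v)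
    (LinearMap.ker_eq_bot.2 hv.fintypeLinearCombination_injective)
  refine ⟨fun b ↦ LinearMap.proj b ∘ₗ g, fun b a ↦ ?_⟩
  have h := LinearMap.congr_fun hg (Pi.single a 1)
  rw [LinearMap.comp_apply, Fintype.linearCombination_apply_single, one_smul] at h
  simp [h, Pi.single_apply, eq_comm]

/-- A basis `c` of the subspace of `Q` where the forms `e` vanish, together with forms `h` that
are dual to `c` and vanish on `f`. -/
theorem exists_complement_basis {m : ℕ} (Q : Submodule ℂ (Fin n → ℂ)) (f : Fin m → Fin n → ℂ)
    (hf : ∀ a, f a ∈ Q) (e : Fin m → Module.Dual ℂ (Fin n → ℂ))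
    (hef : ∀ b a, e b (f a) = if a = b then 1 else 0) :
    ∃ (c : Fin (Module.finrank ℂ Q - m) → Fin n → ℂ)
      (h : Fin (Module.finrank ℂ Q - m) → Module.Dual ℂ (Fin n → ℂ)),
      (∀ j, c j ∈ Q) ∧ (∀ b j, e b (c j) = 0) ∧
      (∀ j j', h j (c j') = if j' = j then 1 else 0) ∧ (∀ j a, h j (f a) = 0) ∧
      ∀ v ∈ Q, (∀ b, e b v = 0) → v ∈ Submodule.span ℂ (Set.range c) := by
  let q : Q →ₗ[ℂ] (Fin m → ℂ) := LinearMap.pi fun b ↦ e b ∘ₗ Q.subtype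
  have hq : ∀ v b, q v b = e b v := fun _ _ ↦ rfl
  have hqs : Function.Surjective q := by
    intro t
    refine ⟨∑ a, t a • ⟨f a, hf a⟩, ?_⟩
    ext b
    simp [hq, hef]
  obtain ⟨W, hW⟩ : ∃ W, W = (LinearMap.ker q).map Q.subtype := ⟨_, rfl⟩
  have hfin : Module.finrank ℂ W = Module.finrank ℂ Q - m := by
    have := q.finrank_range_add_finrank_ker
    rw [LinearMap.range_eq_top.2 hqs, finrank_top, Module.finrank_fin_fun] at this
    rw [hW, Submodule.finrank_map_subtype_eq]
    omega
  have hmem : ∀ v, v ∈ W ↔ v ∈ Q ∧ ∀ b, e b v = 0 := by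
    intro v
    rw [hW, Submodule.mem_map]
    constructor
    · rintro ⟨v, hv, rfl⟩
      exact ⟨v.2, fun b ↦ congrFun (LinearMap.mem_ker.1 hv) b⟩
    · rintro ⟨hv, hev⟩
      exact ⟨⟨v, hv⟩, LinearMap.mem_ker.2 (funext hev), rfl⟩
  clear_value q
  let B := Module.finBasisOfFinrankEq ℂ W hfin
  obtain ⟨c, hc⟩ : ∃ c, c = W.subtype ∘ B := ⟨_, rfl⟩
  have hcW : ∀ j, c j ∈ W := fun j ↦ hc ▸ (B j).2
  have hli : LinearIndependent ℂ c := hc ▸ B.linearIndependent.map' W.subtype W.ker_subtype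
  have hspan : Submodule.span ℂ (Set.range c) = W := by
    rw [hc, Set.range_comp, Submodule.span_image, B.span_eq, Submodule.map_top,
      Submodule.range_subtype]
  have hec : ∀ b j, e b (c j) = 0 := fun b j ↦ ((hmem _).1 (hcW j)).2 b
  obtain ⟨h, hh⟩ := hli.exists_dual
  refine ⟨c, fun j ↦ h j - ∑ b, h j (f b) • e b, fun j ↦ ((hmem _).1 (hcW j)).1, hec, ?_, ?_, ?_⟩
  · intro j j'
    simp [hec, hh]
  · intro j a
    simp [hef]
  · intro v hv hev
    rw [hspan]
    exact (hmem v).2 ⟨hv, hev⟩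

theorem prevDim_lt_iff (hk_pos : ∀ i, 0 < k i) (hk : StrictMono k) (i j : Fin s) :
    prevDim k i < k j ↔ i ≤ j := by
  unfold prevDim
  split_ifs with h
  · rw [hk.lt_iff_lt, Fin.lt_def, Fin.le_def]
    simp only
    omega
  · refine iff_of_true (hk_pos j) ?_
    rw [Fin.le_def]
    omega

/-- Every row index below `k i` lies in the block of a unique `j ≤ i`. -/
theorem exists_block {i : Fin s} {a : ℕ} (ha : a < k i) :
    ∃ j ≤ i, ∃ a' : Fin (k j - prevDim k j), a = prevDim k j + a' := by
  obtain ⟨i, hi⟩ := i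
  induction i with
  | zero =>
    have h0 : prevDim k ⟨0, hi⟩ = 0 := by simp [prevDim]
    exact ⟨⟨0, hi⟩, le_rfl, ⟨a, by omega⟩, by simp [h0]⟩
  | succ i ih =>
    by_cases h : a < k ⟨i, by omega⟩
    · obtain ⟨j, hj, a', ha'⟩ := ih (by omega) h
      exact ⟨j, hj.trans (Fin.mk_le_mk.2 (Nat.le_succ i)), a', ha'⟩
    · have h0 : prevDim k ⟨i + 1, hi⟩ = k ⟨i, by omega⟩ := by simp [prevDim]
      exact ⟨⟨i + 1, hi⟩, le_rfl, ⟨a - k ⟨i, by omega⟩, by omega⟩, by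
        simp only [h0]
        omega⟩

/-- The coordinates of an affine chart: for each `i`, the entries of a matrix of size
`(k i - k (i - 1)) × (dim (P i) - k i)`. -/
abbrev ChartIndex (k : Fin s → ℕ) (P : Fin s → Submodule ℂ (Fin n → ℂ)) : Type :=
  (i : Fin s) × (Fin (k i - prevDim k i) × Fin (Module.finrank ℂ (P i) - k i))

theorem card_chartIndex (k : Fin s → ℕ) (P : Fin s → Submodule ℂ (Fin n → ℂ)) :
    Fintype.card (ChartIndex k P) =
      ∑ i, (k i - prevDim k i) * (Module.finrank ℂ (P i) - k i) := by
  simp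

/-- The rows of the flag with coordinates `y` in the chart given by the rows `f` and the vectors
`c`: to the row `f j`, with `j` in the `i`-th block, a combination of the vectors `c i` is added. -/
noncomputable def chartRow (f : ℕ → Fin n → ℂ)
    (c : (i : Fin s) → Fin (Module.finrank ℂ (P i) - k i) → Fin n → ℂ)
    (y : ChartIndex k P → ℂ) (j : ℕ) : Fin n → ℂ :=
  f j + ∑ x : ChartIndex k P,
    if prevDim k x.1 + x.2.1 = j then y x • c x.1 x.2.2 else 0

/-- The Plücker–Segre coordinates of `chartRow f c y` as polynomials in `y`. -/
noncomputable def chartPolynomial (f : ℕ → Fin n → ℂ)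
    (c : (i : Fin s) → Fin (Module.finrank ℂ (P i) - k i) → Fin n → ℂ)
    (J : PluckerIndex n k) : MvPolynomial (ChartIndex k P) ℂ :=
  ∏ i, (Matrix.of fun a b : Fin (k i) ↦ (C (f a (J i b)) + ∑ x : ChartIndex k P,
    if prevDim k x.1 + x.2.1 = (a : ℕ) then X x * C (c x.1 x.2.2 (J i b)) else 0)).det

theorem eval_chartPolynomial (f : ℕ → Fin n → ℂ)
    (c : (i : Fin s) → Fin (Module.finrank ℂ (P i) - k i) → Fin n → ℂ)
    (y : ChartIndex k P → ℂ) (J : PluckerIndex n k) :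
    eval y (chartPolynomial f c J) = pluckerVector (rowFrame k (chartRow f c y)) J := by
  simp only [chartPolynomial, pluckerVector, map_prod]
  refine Finset.prod_congr rfl fun i _ ↦ ?_
  rw [RingHom.map_det]
  congr 1
  ext a b
  simp only [RingHom.mapMatrix_apply, Matrix.map_apply, Matrix.of_apply, map_add, eval_C, map_sum,
    rowFrame, chartRow, Pi.add_apply, Finset.sum_apply]
  congr 1
  refine Finset.sum_congr rfl fun x _ ↦ ?_
  split_ifs <;> simp

theorem chartRow_block (hk_pos : ∀ i, 0 < k i) (hk : StrictMono k) (f : ℕ → Fin n → ℂ)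
    (c : (i : Fin s) → Fin (Module.finrank ℂ (P i) - k i) → Fin n → ℂ)
    (y : ChartIndex k P → ℂ) (i : Fin s) (a : Fin (k i - prevDim k i)) :
    chartRow f c y (prevDim k i + a) =
      f (prevDim k i + a) + ∑ m, y ⟨i, a, m⟩ • c i m := by
  unfold chartRow
  congr 1
  rw [Fintype.sum_sigma, Finset.sum_eq_single i]
  · rw [Fintype.sum_prod_type, Finset.sum_eq_single a]
    · simp
    · intro a' _ ha'
      refine Finset.sum_eq_zero fun m _ ↦ if_neg ?_
      simpa [Fin.ext_iff] using ha'
    · simp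
  · intro i' _ hi'
    refine Finset.sum_eq_zero fun x _ ↦ if_neg fun h ↦ hi' ?_
    have h₁ := x.1.2
    have h₂ := a.2
    simp only at h
    exact le_antisymm ((prevDim_lt_iff hk_pos hk _ _).1 (by omega))
      ((prevDim_lt_iff hk_pos hk _ _).1 (by omega))
  · simp

end Charts

section ChartData

open MvPolynomial

variable {n s : ℕ} {k : Fin s → ℕ} {P : Fin s → Submodule ℂ (Fin n → ℂ)}

/-- The data defining an affine chart: rows `f` of a restrictive flag, linear forms `e` dual to
them, a basis `c i` of the subspace of `P i` where the first `k i` of the forms `e` vanish, and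
linear forms `h i` dual to `c i` that vanish on the first `k i` rows. The chart consists of the
flags `V` such that the first `k i` forms `e` are coordinates on `V i` for all `i`. -/
structure ChartData (k : Fin s → ℕ) (P : Fin s → Submodule ℂ (Fin n → ℂ)) where
  f : ℕ → Fin n → ℂ
  e : ℕ → Module.Dual ℂ (Fin n → ℂ)
  c : (i : Fin s) → Fin (Module.finrank ℂ (P i) - k i) → Fin n → ℂ
  h : (i : Fin s) → Fin (Module.finrank ℂ (P i) - k i) → Module.Dual ℂ (Fin n → ℂ)
  f_mem : ∀ i, ∀ a < k i, f a ∈ P i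
  e_f : ∀ i, ∀ b < k i, ∀ a < k i, e b (f a) = if a = b then 1 else 0
  c_mem : ∀ i m, c i m ∈ P i
  e_c : ∀ i, ∀ b < k i, ∀ m, e b (c i m) = 0
  h_c : ∀ i m m', h i m (c i m') = if m' = m then 1 else 0
  h_f : ∀ i m, ∀ a < k i, h i m (f a) = 0
  mem_span : ∀ i, ∀ v ∈ P i, (∀ b < k i, e b v = 0) → v ∈ Submodule.span ℂ (Set.range (c i))

/-- Every restrictive flag is the origin of a chart. -/
theorem RestrictiveFlag.exists_chartData (F : RestrictiveFlag k P) :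
    ∃ D : ChartData k P, ∀ i, Submodule.span ℂ (Set.range (rowFrame k D.f i)) = F.V i := by
  obtain ⟨f, hf, hfF⟩ := F.exists_rows
  obtain ⟨e, he⟩ := hf.exists_dual
  have hle : ∀ i, k i ≤ Finset.univ.sup k := fun i ↦ Finset.le_sup (Finset.mem_univ i)
  let e' : ℕ → Module.Dual ℂ (Fin n → ℂ) := fun b ↦
    if hb : b < Finset.univ.sup k then e ⟨b, hb⟩ else 0
  have he' : ∀ i, ∀ b < k i, ∀ a < k i, e' b (f a) = if a = b then 1 else 0 := by
    intro i b hb a ha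
    have hb' := hb.trans_le (hle i)
    rw [show e' b = e ⟨b, hb'⟩ from dif_pos hb', he ⟨b, hb'⟩ ⟨a, ha.trans_le (hle i)⟩]
    simp only [Fin.mk.injEq]
  have hfP : ∀ i, ∀ a < k i, f a ∈ P i := fun i a ha ↦
    F.le i (hfF i ▸ Submodule.subset_span ⟨⟨a, ha⟩, rfl⟩)
  choose c h hcP hec hhc hhf hspan using fun i ↦ exists_complement_basis (P i)
    (fun a : Fin (k i) ↦ f a) (fun a ↦ hfP i a a.2) (fun b : Fin (k i) ↦ e' b)
    (fun b a ↦ (he' i b b.2 a a.2).trans (by simp only [Fin.ext_iff]))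
  exact ⟨⟨f, e', c, h, hfP, he', hcP, fun i b hb m ↦ hec i ⟨b, hb⟩ m, hhc,
    fun i m a ha ↦ hhf i m ⟨a, ha⟩, fun i v hv hev ↦ hspan i v hv fun b ↦ hev b b.2⟩, hfF⟩

namespace ChartData

variable (D : ChartData k P)

/-- The linear form in the Plücker–Segre coordinates whose nonvanishing defines the chart. -/
noncomputable def form : MvPolynomial (PluckerIndex n k) ℂ :=
  ∑ J, C (dualCoeff (fun _ c ↦ D.e c) J) * X J

/-- The square matrix of the coordinates `e` on the `i`-th member of a tuple of frames. -/
noncomputable def coordMatrix (b : (i : Fin s) → Fin (k i) → Fin n → ℂ) (i : Fin s) :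
    Matrix (Fin (k i)) (Fin (k i)) ℂ :=
  Matrix.of fun a c ↦ D.e c (b i a)

theorem isHomogeneous_form : D.form.IsHomogeneous 1 :=
  IsHomogeneous.sum _ _ _ fun J _ ↦ (isHomogeneous_X ℂ J).C_mul _

theorem eval_form (b : (i : Fin s) → Fin (k i) → Fin n → ℂ) :
    eval (pluckerVector b) D.form = ∏ i, (D.coordMatrix b i).det := by
  simp only [form, map_sum, map_mul, eval_C, eval_X]
  exact (prod_det_dual_eq_sum _ _).symm

theorem chartRow_mem (hk_pos : ∀ i, 0 < k i) (hk : StrictMono k) (hP : Monotone P)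
    (y : ChartIndex k P → ℂ) (i : Fin s) (j : ℕ) (hj : j < k i) :
    chartRow D.f D.c y j ∈ P i := by
  obtain ⟨i', hi', a, rfl⟩ := exists_block hj
  rw [chartRow_block hk_pos hk]
  exact Submodule.add_mem _ (D.f_mem i _ hj) (Submodule.sum_mem _ fun m _ ↦
    Submodule.smul_mem _ _ (hP hi' (D.c_mem i' m)))

/-- A row of the `j`-th block has the same first `k j` coordinates `e` as the corresponding row
`f`. -/
theorem e_chartRow (hk_pos : ∀ i, 0 < k i) (hk : StrictMono k)
    (y : ChartIndex k P → ℂ) {j : Fin s} (a : Fin (k j - prevDim k j))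
    (b : ℕ) (hb : b < k j) :
    D.e b (chartRow D.f D.c y (prevDim k j + a)) =
      if prevDim k j + a = b then 1 else 0 := by
  have ha := a.2
  rw [chartRow_block hk_pos hk, map_add, map_sum, D.e_f j b hb _ (by omega)]
  simp [D.e_c j b hb]

theorem det_coordMatrix_chartRow (hk_pos : ∀ i, 0 < k i) (hk : StrictMono k)
    (y : ChartIndex k P → ℂ) (i : Fin s) :
    (D.coordMatrix (rowFrame k (chartRow D.f D.c y)) i).det = 1 := by
  have hentry : ∀ a b : Fin (k i), b ≤ a →
      D.coordMatrix (rowFrame k (chartRow D.f D.c y)) i a b = if a = b then 1 else 0 := by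
    intro a b hba
    obtain ⟨j, -, a', ha'⟩ := exists_block a.2
    have hlt := a'.2
    have hba' : (b : ℕ) ≤ a := hba
    have h := D.e_chartRow hk_pos hk y a' b (by omega)
    rw [← ha'] at h
    simpa only [coordMatrix, Matrix.of_apply, rowFrame, Fin.ext_iff] using h
  rw [Matrix.det_of_isUpperTriangular]
  · exact Finset.prod_eq_one fun a _ ↦ by rw [hentry a a le_rfl, if_pos rfl]
  · intro a b hba
    rw [hentry a b (le_of_lt hba), if_neg (show ¬ a = b from ne_of_gt hba)]

theorem eval_form_chart (hk_pos : ∀ i, 0 < k i) (hk : StrictMono k)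
    (y : ChartIndex k P → ℂ) :
    eval (pluckerVector (rowFrame k (chartRow D.f D.c y))) D.form = 1 := by
  rw [D.eval_form]
  exact Finset.prod_eq_one fun i _ ↦ D.det_coordMatrix_chartRow hk_pos hk y i

theorem pluckerVector_chart_ne_zero (hk_pos : ∀ i, 0 < k i) (hk : StrictMono k)
    (y : ChartIndex k P → ℂ) : pluckerVector (rowFrame k (chartRow D.f D.c y)) ≠ 0 := by
  intro h
  have h1 := D.eval_form_chart hk_pos hk y
  rw [h, form] at h1
  simp at h1

/-- The linear forms used to recover the coordinate `x` of a chart: the forms `e`, with the one at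
the row index of `x` replaced by the form `h` at the column index of `x`. -/
noncomputable def coordForms (x : ChartIndex k P) :
    (i : Fin s) → Fin (k i) → Module.Dual ℂ (Fin n → ℂ) :=
  fun i b ↦ if x.1 = i ∧ prevDim k x.1 + x.2.1 = b then D.h x.1 x.2.2 else D.e b

/-- The coordinates of a chart are linear combinations of the Plücker–Segre coordinates: a row of
the last block of the `i`-th coordinate matrix is a row of the identity matrix, so Cramer's
rule gives the value of `h` on the corresponding row of the chart. -/
theorem sum_dualCoeff_mul_pluckerVector (hk_pos : ∀ i, 0 < k i) (hk : StrictMono k)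
    (y : ChartIndex k P → ℂ) (x : ChartIndex k P) :
    ∑ J, dualCoeff (D.coordForms x) J * pluckerVector (rowFrame k (chartRow D.f D.c y)) J =
      y x := by
  obtain ⟨i, a, m⟩ := x
  have ha := a.2
  set j₀ : Fin (k i) := ⟨prevDim k i + a, by omega⟩
  set b := rowFrame k (chartRow D.f D.c y)
  set M := D.coordMatrix b i
  have hM : M.det = 1 := D.det_coordMatrix_chartRow hk_pos hk y i
  have hrow : ∀ b, M j₀ b = if j₀ = b then 1 else 0 := by
    intro b
    exact (D.e_chartRow hk_pos hk y a b b.2).trans (if_congr (by rw [Fin.ext_iff]) rfl rfl)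
  rw [← prod_det_dual_eq_sum, Finset.prod_eq_single i]
  · have hcol : (Matrix.of fun a' c ↦ D.coordForms ⟨i, a, m⟩ i c (b i a')) =
        M.updateCol j₀ fun a' ↦ D.h i m (b i a') := by
      ext a' c
      by_cases hc : c = j₀
      · subst hc
        simp [coordForms, j₀]
      · have hc' : ¬ prevDim k i + a = c := fun h ↦ hc (Fin.ext h.symm)
        simp [coordForms, hc, hc', M, coordMatrix]
    have hcramer := congrFun (M.mulVec_cramer fun a' ↦ D.h i m (b i a')) j₀
    rw [hM, one_smul] at hcramer
    rw [hcol, ← Matrix.cramer_apply]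
    have hlhs : M.mulVec (M.cramer fun a' ↦ D.h i m (b i a')) j₀ =
        M.cramer (fun a' ↦ D.h i m (b i a')) j₀ := by
      simp [Matrix.mulVec, dotProduct, hrow]
    rw [← hlhs, hcramer]
    change D.h i m (chartRow D.f D.c y (prevDim k i + a)) = _
    rw [chartRow_block hk_pos hk, map_add, map_sum, D.h_f i m _ (by omega)]
    simp [D.h_c]
  · intro i' _ hi'
    refine Eq.trans ?_ (D.det_coordMatrix_chartRow hk_pos hk y i')
    congr 1
    ext a' c
    simp [coordForms, hi'.symm, coordMatrix, b]
  · simp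

/-- Every restrictive flag at which the linear form of the chart does not vanish lies in the
chart. -/
theorem exists_chart_coordinates (hk_pos : ∀ i, 0 < k i) (hk : StrictMono k)
    (G : RestrictiveFlag k P) (hG : eval (pluckerVector G.frame) D.form ≠ 0) :
    ∃ y : ChartIndex k P → ℂ, ∀ i,
      Submodule.span ℂ (Set.range (rowFrame k (chartRow D.f D.c y) i)) = G.V i := by
  rw [D.eval_form] at hG
  have hM : ∀ i, IsUnit (D.coordMatrix G.frame i).det := fun i ↦
    (Finset.prod_ne_zero_iff.1 hG i (Finset.mem_univ i)).isUnit
  let r : (i : Fin s) → Fin (k i) → Fin n → ℂ := fun i ↦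
    changeFrame (D.coordMatrix G.frame i)⁻¹ (G.frame i)
  have hrG : ∀ i a, r i a ∈ G.V i := by
    intro i a
    rw [← G.span_frame]
    exact span_changeFrame_le _ _ (Submodule.subset_span ⟨a, rfl⟩)
  have hre : ∀ i, ∀ a b : Fin (k i), D.e b (r i a) = if a = b then 1 else 0 := by
    intro i a b
    have h := congrFun (congrFun (Matrix.nonsing_inv_mul _ (hM i)) a) b
    rw [Matrix.mul_apply, Matrix.one_apply] at h
    rw [← h]
    simp [r, changeFrame, coordMatrix]
  have hdiff : ∀ i, ∀ a : Fin (k i), ∃ μ : Fin (Module.finrank ℂ (P i) - k i) → ℂ,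
      ∑ m, μ m • D.c i m = r i a - D.f a := by
    intro i a
    refine (Submodule.mem_span_range_iff_exists_fun ℂ).1 (D.mem_span i _
      (Submodule.sub_mem _ (G.le i (hrG i a)) (D.f_mem i a a.2)) fun b hb ↦ ?_)
    have h := hre i a ⟨b, hb⟩
    simp only [Fin.ext_iff] at h
    rw [map_sub, D.e_f i b hb a a.2, h, sub_self]
  choose μ hμ using hdiff
  let y : ChartIndex k P → ℂ := fun x ↦
    μ x.1 ⟨prevDim k x.1 + x.2.1, by have := x.2.1.2; omega⟩ x.2.2
  refine ⟨y, fun i ↦ Submodule.eq_of_le_of_finrank_eq ?_ ?_⟩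
  · rw [Submodule.span_le]
    rintro _ ⟨⟨j, hj⟩, rfl⟩
    obtain ⟨i', hi', a, rfl⟩ := exists_block hj
    have ha := a.2
    have h := hμ i' ⟨prevDim k i' + a, by omega⟩
    have hrow : rowFrame k (chartRow D.f D.c y) i ⟨prevDim k i' + a, hj⟩ =
        r i' ⟨prevDim k i' + a, by omega⟩ := by
      change chartRow D.f D.c y (prevDim k i' + a) = _
      rw [chartRow_block hk_pos hk, ← sub_eq_iff_eq_add'.1 h.symm]
    rw [hrow]
    exact G.mono hi' (hrG i' _)
  · rw [finrank_span_eq_card (linearIndependent_of_pluckerVector_ne_zero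
      (D.pluckerVector_chart_ne_zero hk_pos hk y) i), Fintype.card_fin, G.finrank_eq]

end ChartData

theorem eval_aeval_eq {σ τ : Type*} (φ : σ → MvPolynomial τ ℂ) (y : τ → ℂ)
    (p : MvPolynomial σ ℂ) : eval y (aeval φ p) = eval (fun J ↦ eval y (φ J)) p := by
  induction p using MvPolynomial.induction_on with
  | C a => simp
  | add p q hp hq => rw [map_add, map_add, map_add, hp, hq]
  | mul_X p i hp => rw [map_mul, map_mul, map_mul, hp, aeval_X, eval_X]

/-- Around each restrictive flag there is a chart: an affine space, embedded in the affine space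
where a linear form is `1` by polynomials that generate the coordinate ring, and consisting of all
restrictive flags where the linear form does not vanish. -/
theorem RestrictiveFlag.exists_chart (hk_pos : ∀ i, 0 < k i) (hk : StrictMono k)
    (hP : Monotone P) (F : RestrictiveFlag k P) :
    ∃ (l : MvPolynomial (PluckerIndex n k) ℂ)
      (φ : PluckerIndex n k → MvPolynomial (ChartIndex k P) ℂ),
      l.IsHomogeneous 1 ∧ aeval φ l = 1 ∧ Function.Surjective (aeval (R := ℂ) φ) ∧
      eval (pluckerVector F.frame) l ≠ 0 ∧
      (∀ y, ∃ G : RestrictiveFlag k P, ∃ h,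
        G.plucker = Projectivization.mk ℂ (fun J ↦ eval y (φ J)) h) ∧
      ∀ G : RestrictiveFlag k P, eval (pluckerVector G.frame) l ≠ 0 →
        ∃ y h, G.plucker = Projectivization.mk ℂ (fun J ↦ eval y (φ J)) h := by
  obtain ⟨D, hD⟩ := F.exists_chartData
  have hφ : ∀ y : ChartIndex k P → ℂ, (fun J ↦ eval y (chartPolynomial D.f D.c J)) =
      pluckerVector (rowFrame k (chartRow D.f D.c y)) := by
    intro y
    ext J
    exact eval_chartPolynomial D.f D.c y J
  have hne := D.pluckerVector_chart_ne_zero hk_pos hk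
  refine ⟨D.form, chartPolynomial D.f D.c, D.isHomogeneous_form, ?_, ?_, ?_, ?_, ?_⟩
  · refine MvPolynomial.funext fun y ↦ ?_
    rw [eval_aeval_eq, hφ, D.eval_form_chart hk_pos hk y, map_one]
  · rw [← AlgHom.range_eq_top, ← top_le_iff, ← adjoin_range_X, Algebra.adjoin_le_iff]
    rintro _ ⟨x, rfl⟩
    refine ⟨∑ J, C (dualCoeff (D.coordForms x) J) * X J, MvPolynomial.funext fun y ↦ ?_⟩
    refine (eval_aeval_eq _ _ _).trans ?_
    rw [hφ, eval_X, ← D.sum_dualCoeff_mul_pluckerVector hk_pos hk y x]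
    simp only [map_sum, map_mul, eval_C, eval_X]
  · rw [D.eval_form]
    refine Finset.prod_ne_zero_iff.2 fun i _ ↦ ?_
    obtain ⟨A, hA⟩ := exists_eq_changeFrame (b := rowFrame k D.f i) (b' := F.frame i) fun a ↦ by
      rw [F.span_frame, ← hD]
      exact Submodule.subset_span ⟨a, rfl⟩
    have hmul : A * D.coordMatrix F.frame i = 1 := by
      ext a b
      have h := D.e_f i b b.2 a a.2
      rw [show D.f a = changeFrame A (F.frame i) a from congrFun hA a] at h
      rw [Matrix.one_apply, Matrix.mul_apply]
      simpa [changeFrame, ChartData.coordMatrix, Fin.ext_iff] using h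
    exact (Matrix.isUnit_det_of_left_inverse hmul).ne_zero
  · intro y
    simp only [hφ]
    obtain ⟨G, hG⟩ := exists_flag_of_rows hk.monotone (D.chartRow_mem hk_pos hk hP y) (hne y)
    exact ⟨G, hne y, hG⟩
  · intro G hG
    obtain ⟨y, hy⟩ := D.exists_chart_coordinates hk_pos hk G hG
    refine ⟨y, ?_⟩
    simp only [hφ]
    exact ⟨hne y, G.plucker_eq_mk hy (hne y)⟩

end ChartData

/-! ### Complex points of projective space -/

section ComplexPoints

open MvPolynomial TopologicalSpace

variable {ι : Type}

theorem MvPolynomial.IsHomogeneous.eval_smul {f : MvPolynomial ι ℂ} {d : ℕ}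
    (hf : f.IsHomogeneous d) (t : ℂ) (v : ι → ℂ) : eval (t • v) f = t ^ d * eval v f := by
  rw [eval_eq, eval_eq, Finset.mul_sum]
  refine Finset.sum_congr rfl fun m hm ↦ ?_
  have hd : ∑ i ∈ m.support, m i = d := by
    have h := hf (mem_support_iff.1 hm)
    rwa [Finsupp.weight_apply, Finsupp.sum, Finset.sum_congr rfl fun i _ ↦ by
      rw [Pi.one_apply, smul_eq_mul, mul_one]] at h
  simp only [Pi.smul_apply, smul_eq_mul, mul_pow, Finset.prod_mul_distrib,
    Finset.prod_pow_eq_pow_sum, hd]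
  ring

theorem eval_rep_eq_zero_iff {f : MvPolynomial ι ℂ} {d : ℕ} (hf : f.IsHomogeneous d)
    {v : ι → ℂ} (hv : v ≠ 0) :
    eval (Projectivization.mk ℂ v hv).rep f = 0 ↔ eval v f = 0 := by
  obtain ⟨a, ha⟩ := Projectivization.exists_smul_eq_mk_rep ℂ v hv
  rw [← ha, Units.smul_def, hf.eval_smul, mul_eq_zero,
    or_iff_right (pow_ne_zero _ (Units.ne_zero a))]

theorem mem_complexPoint_iff {f : MvPolynomial ι ℂ} {d : ℕ} (hf : f.IsHomogeneous d)
    (p : ℙ ℂ (ι → ℂ)) : f ∈ (complexPoint p).asHomogeneousIdeal ↔ eval p.rep f = 0 :=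
  ⟨fun h ↦ RingHom.mem_ker.1 (Ideal.homogeneousCore'_le _ _ h), fun h ↦
    Ideal.mem_homogeneousCore_of_homogeneous_of_mem ⟨d, hf⟩ (RingHom.mem_ker.2 h)⟩

theorem mem_complexPoint_mk_iff {f : MvPolynomial ι ℂ} {d : ℕ} (hf : f.IsHomogeneous d)
    {v : ι → ℂ} (hv : v ≠ 0) :
    f ∈ (complexPoint (Projectivization.mk ℂ v hv)).asHomogeneousIdeal ↔ eval v f = 0 :=
  (mem_complexPoint_iff hf _).trans (eval_rep_eq_zero_iff hf hv)

/-- Homogeneous ideals are determined by their homogeneous elements. -/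
theorem homogeneousIdeal_le_iff {I J : HomogeneousIdeal (homogeneousSubmodule ι ℂ)} :
    I ≤ J ↔ ∀ d, ∀ f : MvPolynomial ι ℂ, f.IsHomogeneous d → f ∈ I → f ∈ J := by
  classical
  refine ⟨fun h d f _ hf ↦ h hf, fun h f hf ↦ ?_⟩
  change f ∈ J.toIdeal
  rw [← DirectSum.sum_support_decompose (homogeneousSubmodule ι ℂ) f]
  exact Ideal.sum_mem _ fun i _ ↦ h i _
    (DirectSum.decompose (homogeneousSubmodule ι ℂ) f i).2 (I.isHomogeneous i hf)

theorem mem_of_mem_closure_complexPoint {S : Set (ℙ ℂ (ι → ℂ))} {x : ProjSpace ι}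
    (hx : x ∈ closure (complexPoint '' S)) {d : ℕ} {f : MvPolynomial ι ℂ}
    (hf : f.IsHomogeneous d) (hS : ∀ p ∈ S, eval p.rep f = 0) : f ∈ x.asHomogeneousIdeal := by
  by_contra hfx
  obtain ⟨_, hpU, p, hp, rfl⟩ := mem_closure_iff.1 hx
    (Proj.basicOpen (homogeneousSubmodule ι ℂ) f) (Proj.basicOpen _ f).isOpen hfx
  exact hpU ((mem_complexPoint_iff hf p).2 (hS p hp))

theorem exists_homogeneous_of_mem_open {U : Set (ProjSpace ι)} (hU : IsOpen U)
    {p : ℙ ℂ (ι → ℂ)} (hp : complexPoint p ∈ U) :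
    ∃ (d : ℕ) (f : MvPolynomial ι ℂ), f.IsHomogeneous d ∧ eval p.rep f ≠ 0 ∧
      ∀ q : ℙ ℂ (ι → ℂ), eval q.rep f ≠ 0 → complexPoint q ∈ U := by
  obtain ⟨_, ⟨_, ⟨g, rfl⟩, rfl⟩, hpg, hgU⟩ :=
    (Proj.isBasis_basicOpen (homogeneousSubmodule ι ℂ)).exists_subset_of_mem_open hp hU
  rw [Proj.basicOpen_eq_iSup_proj] at hpg hgU
  obtain ⟨i, hi⟩ := Opens.mem_iSup.1 hpg
  have hhom : (GradedRing.proj (homogeneousSubmodule ι ℂ) i g).IsHomogeneous i :=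
    (DirectSum.decompose (homogeneousSubmodule ι ℂ) g i).2
  refine ⟨i, _, hhom, fun h ↦ hi ((mem_complexPoint_iff hhom p).2 h), fun q hq ↦ hgU ?_⟩
  exact Opens.mem_iSup.2 ⟨i, fun h ↦ hq ((mem_complexPoint_iff hhom q).1 h)⟩

/-- The projective Nullstellensatz: every point of projective space specializes to a complex
point. -/
theorem exists_complexPoint_specialization [Finite ι] (x : ProjSpace ι) :
    ∃ p : ℙ ℂ (ι → ℂ), complexPoint p ∈ closure {x} := by
  classical
  have hprime : x.asHomogeneousIdeal.toIdeal.IsPrime := x.isPrime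
  obtain ⟨v, hv, hv0⟩ :
      ∃ v ∈ zeroLocus ℂ x.asHomogeneousIdeal.toIdeal, v ≠ 0 := by
    by_contra! h
    refine x.not_irrelevant_le fun f hf ↦ ?_
    change f ∈ x.asHomogeneousIdeal.toIdeal
    rw [← IsPrime.vanishingIdeal_zeroLocus (K := ℂ) x.asHomogeneousIdeal.toIdeal,
      mem_vanishingIdeal_iff]
    intro v hv
    rw [h v hv, aeval_def, Algebra.algebraMap_self, eval₂_id]
    rw [← DirectSum.sum_support_decompose (homogeneousSubmodule ι ℂ) f, map_sum]
    refine Finset.sum_eq_zero fun i _ ↦ ?_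
    have hhom := (DirectSum.decompose (homogeneousSubmodule ι ℂ) f i).2
    rcases Nat.eq_zero_or_pos i with rfl | hi
    · have h0 := (HomogeneousIdeal.mem_irrelevant_iff _ f).1 hf
      rw [GradedRing.proj_apply] at h0
      rw [h0, map_zero]
    · have h0 := IsHomogeneous.eval_smul hhom 0 0
      rwa [smul_zero, zero_pow hi.ne', zero_mul] at h0
  refine ⟨Projectivization.mk ℂ v hv0, (ProjectiveSpectrum.le_iff_mem_closure _ _ _).1 ?_⟩
  change x.asHomogeneousIdeal ≤ _
  rw [homogeneousIdeal_le_iff]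
  intro d f hf hfx
  rw [mem_complexPoint_mk_iff hf]
  have := hv f hfx
  rwa [aeval_def, Algebra.algebraMap_self, eval₂_id] at this

/-- Any two points of `S` lie on a polynomial curve whose points are in `S`. -/
def JoinedByCurves (S : Set (ℙ ℂ (ι → ℂ))) : Prop :=
  ∀ p ∈ S, ∀ q ∈ S, ∃ γ : ι → Polynomial ℂ,
    (∃ h, p = Projectivization.mk ℂ (fun i ↦ (γ i).eval 0) h) ∧
    (∃ h, q = Projectivization.mk ℂ (fun i ↦ (γ i).eval 1) h) ∧
    ∀ t, ∀ h : (fun i ↦ (γ i).eval t) ≠ 0, Projectivization.mk ℂ (fun i ↦ (γ i).eval t) h ∈ S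

theorem eval_aeval_curve (γ : ι → Polynomial ℂ) (t : ℂ) (f : MvPolynomial ι ℂ) :
    (aeval γ f).eval t = eval (fun i ↦ (γ i).eval t) f := by
  induction f using MvPolynomial.induction_on with
  | C a => simp
  | add p q hp hq => rw [map_add, map_add, Polynomial.eval_add, hp, hq]
  | mul_X p i hp => rw [map_mul, map_mul, Polynomial.eval_mul, hp, aeval_X, eval_X]

/-- A polynomial curve has a point in the intersection of two open sets that both meet it: the
product of two nonzero polynomials in one variable is nonzero. -/
theorem JoinedByCurves.isPreirreducible {S : Set (ℙ ℂ (ι → ℂ))} (hS : JoinedByCurves S) :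
    IsPreirreducible (complexPoint '' S) := by
  rintro U V hU hV ⟨_, ⟨p, hp, rfl⟩, hpU⟩ ⟨_, ⟨q, hq, rfl⟩, hqV⟩
  obtain ⟨d, f, hf, hfp, hfU⟩ := exists_homogeneous_of_mem_open hU hpU
  obtain ⟨e, g, hg, hgq, hgV⟩ := exists_homogeneous_of_mem_open hV hqV
  obtain ⟨γ, ⟨h0, rfl⟩, ⟨h1, rfl⟩, hγ⟩ := hS p hp q hq
  obtain ⟨i, hi⟩ := Function.ne_iff.1 h0
  rw [Ne, eval_rep_eq_zero_iff hf] at hfp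
  rw [Ne, eval_rep_eq_zero_iff hg] at hgq
  have hne : aeval γ f * aeval γ g * γ i ≠ 0 := by
    refine mul_ne_zero (mul_ne_zero ?_ ?_) ?_
    · intro h
      exact hfp (by rw [← eval_aeval_curve, h, Polynomial.eval_zero])
    · intro h
      exact hgq (by rw [← eval_aeval_curve, h, Polynomial.eval_zero])
    · intro h
      exact hi (by simp [h])
  obtain ⟨t, ht⟩ : ∃ t, (aeval γ f * aeval γ g * γ i).eval t ≠ 0 := by
    by_contra! h
    exact hne (Polynomial.funext fun t ↦ by rw [h, Polynomial.eval_zero])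
  simp only [Polynomial.eval_mul, ne_eq, mul_eq_zero, not_or, eval_aeval_curve] at ht
  have hγt : (fun i ↦ (γ i).eval t) ≠ 0 := fun h ↦ ht.2 (congrFun h i)
  refine ⟨_, ⟨_, hγ t hγt, rfl⟩, hfU _ ?_, hgV _ ?_⟩
  · rw [Ne, eval_rep_eq_zero_iff hf]
    exact ht.1.1
  · rw [Ne, eval_rep_eq_zero_iff hg]
    exact ht.1.2

/-- A polynomial curve is defined outside finitely many parameters, and the complement of a finite
set in `ℂ` is connected. -/
theorem JoinedByCurves.isPreconnected_classical {S : Set (ℙ ℂ (ι → ℂ))}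
    (hS : JoinedByCurves S) : @_root_.IsPreconnected _ (classicalTopology ι) S := by
  let _ : TopologicalSpace (ℙ ℂ (ι → ℂ)) := classicalTopology ι
  refine isPreconnected_of_forall_pair fun p hp q hq ↦ ?_
  obtain ⟨γ, ⟨h0, rfl⟩, ⟨h1, rfl⟩, hγ⟩ := hS p hp q hq
  obtain ⟨i, hi⟩ := Function.ne_iff.1 h0
  have hγi : γ i ≠ 0 := by
    intro h
    exact hi (by simp [h])
  let T : Set ℂ := {t | (fun i ↦ (γ i).eval t) ≠ 0}
  have hT : IsPathConnected T := by
    have hcount : Tᶜ.Countable := by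
      refine (Set.Finite.subset (γ i).roots.toFinset.finite_toSet fun t ht ↦ ?_).countable
      have ht' : (fun i ↦ (γ i).eval t) = 0 := not_not.1 ht
      simpa [hγi] using congrFun ht' i
    have h := hcount.isPathConnected_compl_of_one_lt_rank (by
      rw [Complex.rank_real_complex]
      exact Nat.one_lt_ofNat)
    rwa [compl_compl] at h
  have : ConnectedSpace T := isConnected_iff_connectedSpace.1 hT.isConnected
  let F : T → ℙ ℂ (ι → ℂ) := fun t ↦ Projectivization.mk ℂ (fun i ↦ (γ i).eval t.1) t.2
  have hF : Continuous F := by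
    have h₁ : Continuous fun v : {v : ι → ℂ // v ≠ 0} ↦ Projectivization.mk ℂ v.1 v.2 :=
      continuous_coinduced_rng
    have h₂ : Continuous fun t : T ↦ (⟨fun i ↦ (γ i).eval t.1, t.2⟩ : {v : ι → ℂ // v ≠ 0}) :=
      Continuous.subtype_mk (continuous_pi fun i ↦
        (γ i).continuous.comp continuous_subtype_val) _
    exact h₁.comp h₂
  refine ⟨Set.range F, ?_, ⟨⟨0, h0⟩, rfl⟩, ⟨⟨1, h1⟩, rfl⟩, isPreconnected_range hF⟩
  rintro _ ⟨t, rfl⟩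
  exact hγ t.1 t.2

end ComplexPoints

/-! ### Affine spaces in projective space -/

section AffineCharts

open MvPolynomial TopologicalSpace HomogeneousLocalization

variable {ι σ : Type} {l : MvPolynomial ι ℂ} {φ : ι → MvPolynomial σ ℂ}

/-- The ring map from the degree zero part of the localization at `l` that substitutes the
polynomials `φ`, at which `l` takes the value `1`. -/
noncomputable def awayAeval (hφ : aeval φ l = 1) :
    Away (homogeneousSubmodule ι ℂ) l →+* MvPolynomial σ ℂ :=
  (IsLocalization.Away.lift (S := Localization.Away l) l
    (g := (aeval φ : MvPolynomial ι ℂ →ₐ[ℂ] MvPolynomial σ ℂ).toRingHom)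
    (by
      rw [AlgHom.toRingHom_eq_coe, RingHom.coe_coe, hφ]
      exact isUnit_one)).comp (algebraMap (Away (homogeneousSubmodule ι ℂ) l) (Localization.Away l))

theorem awayAeval_mk (hl : l ∈ homogeneousSubmodule ι ℂ 1) (hφ : aeval φ l = 1) (m : ℕ)
    (x : MvPolynomial ι ℂ) (hx : x ∈ homogeneousSubmodule ι ℂ (m • 1)) :
    awayAeval hφ (Away.mk (homogeneousSubmodule ι ℂ) hl m x hx) = aeval φ x := by
  rw [awayAeval, RingHom.comp_apply, HomogeneousLocalization.algebraMap_apply, Away.val_mk,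
    Localization.mk_eq_mk']
  unfold IsLocalization.Away.lift
  rw [IsLocalization.lift_mk'_spec, map_pow, AlgHom.toRingHom_eq_coe, RingHom.coe_coe, hφ,
    one_pow, one_mul]

theorem awayAeval_surjective (hl : l ∈ homogeneousSubmodule ι ℂ 1) (hφ : aeval φ l = 1)
    (hsurj : Function.Surjective (aeval (R := ℂ) φ)) : Function.Surjective (awayAeval hφ) := by
  have hC : ∀ a : ℂ, C a ∈ (awayAeval hφ).range := fun a ↦
    ⟨Away.mk _ hl 0 (C a) (by rw [zero_smul]; exact isHomogeneous_C ι a), by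
      rw [awayAeval_mk, aeval_C]; rfl⟩
  intro q
  obtain ⟨p, rfl⟩ := hsurj q
  change aeval φ p ∈ (awayAeval hφ).range
  induction p using MvPolynomial.induction_on with
  | C a =>
    rw [aeval_C]
    exact hC a
  | add p q hp hq =>
    rw [map_add]
    exact add_mem hp hq
  | mul_X p i hp =>
    rw [map_mul]
    refine mul_mem hp ⟨Away.mk _ hl 1 (X i) (by rw [one_smul]; exact isHomogeneous_X ℂ i), ?_⟩
    rw [awayAeval_mk]

theorem awayAeval_fromZeroRingHom (hφ : aeval φ l = 1) (a : homogeneousSubmodule ι ℂ 0) :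
    awayAeval hφ (fromZeroRingHom (homogeneousSubmodule ι ℂ) (Submonoid.powers l) a) =
      aeval φ (a : MvPolynomial ι ℂ) := by
  have h : algebraMap (Away (homogeneousSubmodule ι ℂ) l) (Localization.Away l)
      (fromZeroRingHom (homogeneousSubmodule ι ℂ) (Submonoid.powers l) a) =
      algebraMap (MvPolynomial ι ℂ) (Localization.Away l) a := by
    rw [HomogeneousLocalization.algebraMap_apply, ← Localization.mk_one_eq_algebraMap]
    rfl
  rw [awayAeval, RingHom.comp_apply, h, IsLocalization.Away.lift_eq, AlgHom.toRingHom_eq_coe,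
    RingHom.coe_coe]

/-- The immersion of an affine space into projective space given by polynomials `φ` at which the
linear form `l` is `1`. -/
noncomputable def affineImmersion (hl : l ∈ homogeneousSubmodule ι ℂ 1) (hφ : aeval φ l = 1) :
    Spec (CommRingCat.of (MvPolynomial σ ℂ)) ⟶ ProjSpace ι :=
  Spec.map (CommRingCat.ofHom (awayAeval hφ)) ≫
    Proj.awayι (homogeneousSubmodule ι ℂ) l hl one_pos

theorem affineImmersion_toSpec (hl : l ∈ homogeneousSubmodule ι ℂ 1) (hφ : aeval φ l = 1) :
    affineImmersion hl hφ ≫ ProjSpace.toSpec ι =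
      Spec.map (CommRingCat.ofHom (C : ℂ →+* MvPolynomial σ ℂ)) := by
  rw [affineImmersion, ProjSpace.toSpec, CategoryTheory.Category.assoc,
    Proj.awayι_toSpecZero_assoc, ← Spec.map_comp, ← Spec.map_comp, ← CommRingCat.ofHom_comp,
    ← CommRingCat.ofHom_comp]
  congr 2
  ext1 a
  rw [RingHom.comp_apply, RingHom.comp_apply, awayAeval_fromZeroRingHom]
  exact aeval_C φ a

/-- The point of affine space with coordinates `y`. -/
noncomputable def affinePoint (y : σ → ℂ) : Spec (CommRingCat.of (MvPolynomial σ ℂ)) :=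
  show PrimeSpectrum (MvPolynomial σ ℂ) from ⟨RingHom.ker (eval y), RingHom.ker_isPrime _⟩

theorem affineImmersion_affinePoint (hl : l ∈ homogeneousSubmodule ι ℂ 1)
    (hφ : aeval φ l = 1) (y : σ → ℂ) (hy : (fun i ↦ eval y (φ i)) ≠ 0) :
    affineImmersion hl hφ (affinePoint y) =
      complexPoint (Projectivization.mk ℂ (fun i ↦ eval y (φ i)) hy) := by
  have hpos : ∀ d, 0 < d → ∀ f : MvPolynomial ι ℂ, f ∈ homogeneousSubmodule ι ℂ d →
      (f ∈ (affineImmersion hl hφ (affinePoint y)).asHomogeneousIdeal ↔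
        eval (fun i ↦ eval y (φ i)) f = 0) := by
    intro d hd f hf
    have he : awayAeval hφ (Away.isLocalizationElem hl hf) = aeval φ f :=
      (awayAeval_mk hl hφ d (f ^ 1) _).trans (by rw [pow_one])
    rw [← not_iff_not, ← eval_aeval_eq, ← he]
    have h := congrArg (fun U ↦ Spec.map (CommRingCat.ofHom (awayAeval hφ)) (affinePoint y) ∈ U)
      (Proj.awayι_preimage_basicOpen (homogeneousSubmodule ι ℂ) hl one_pos hf hd)
    exact iff_of_eq h
  -- In degree zero, multiply by `l`, which is nonzero at the point, and use degree one.
  have hmem : ∀ d, ∀ f : MvPolynomial ι ℂ, f ∈ homogeneousSubmodule ι ℂ d →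
      (f ∈ (affineImmersion hl hφ (affinePoint y)).asHomogeneousIdeal ↔
        eval (fun i ↦ eval y (φ i)) f = 0) := by
    intro d f hf
    have hl1 : eval (fun i ↦ eval y (φ i)) l = 1 := by rw [← eval_aeval_eq, hφ, map_one]
    have hlI := hpos 1 one_pos l hl
    have hfl := hpos (d + 1) d.succ_pos (f * l) (SetLike.mul_mem_graded hf hl)
    have hprime := (affineImmersion hl hφ (affinePoint y)).isPrime
    rw [hl1, eq_false one_ne_zero, iff_false] at hlI
    rw [map_mul, hl1, mul_one] at hfl
    exact ⟨fun h ↦ hfl.1 (Ideal.mul_mem_right _ _ h), fun h ↦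
      (hprime.mem_or_mem (hfl.2 h)).resolve_right hlI⟩
  apply ProjectiveSpectrum.ext
  refine le_antisymm (homogeneousIdeal_le_iff.2 fun d f hf h ↦ ?_)
    (homogeneousIdeal_le_iff.2 fun d f hf h ↦ ?_)
  · exact (mem_complexPoint_mk_iff hf hy).2 ((hmem d f hf).1 h)
  · exact (hmem d f hf).2 ((mem_complexPoint_mk_iff hf hy).1 h)

end AffineCharts

section Immersion

open MvPolynomial TopologicalSpace CategoryTheory

variable {ι σ : Type} {l : MvPolynomial ι ℂ} {φ : ι → MvPolynomial σ ℂ}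

theorem top_le_affineImmersion_preimage (hl : l ∈ homogeneousSubmodule ι ℂ 1)
    (hφ : aeval φ l = 1) :
    ⊤ ≤ affineImmersion hl hφ ⁻¹ᵁ Proj.basicOpen (homogeneousSubmodule ι ℂ) l := by
  intro x _
  have h : Proj.awayι (homogeneousSubmodule ι ℂ) l hl one_pos
      (Spec.map (CommRingCat.ofHom (awayAeval hφ)) x) ∈
      (Proj.awayι (homogeneousSubmodule ι ℂ) l hl one_pos).opensRange := ⟨_, rfl⟩
  rwa [Proj.opensRange_awayι] at h

/-- If the polynomials `φ` generate the polynomial ring, then the affine space is embedded as a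
closed subscheme of the affine open set where `l` does not vanish. -/
theorem affineImmersion_appLE_surjective (hl : l ∈ homogeneousSubmodule ι ℂ 1)
    (hφ : aeval φ l = 1) (hsurj : Function.Surjective (aeval (R := ℂ) φ)) :
    Function.Surjective ((affineImmersion hl hφ).appLE
      (Proj.basicOpen (homogeneousSubmodule ι ℂ) l) ⊤
      (top_le_affineImmersion_preimage hl hφ)) := by
  set U := Proj.basicOpen (homogeneousSubmodule ι ℂ) l
  set a := Proj.awayι (homogeneousSubmodule ι ℂ) l hl one_pos with ha
  have hU : U = a.opensRange := (Proj.opensRange_awayι _ l hl one_pos).symm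
  have htop : a ⁻¹ᵁ U = ⊤ := by
    rw [hU]
    exact a.preimage_opensRange
  have h₁ : (⊤ : (Spec (CommRingCat.of (HomogeneousLocalization.Away
      (homogeneousSubmodule ι ℂ) l))).Opens) ≤ a ⁻¹ᵁ U := htop.ge
  have h₂ : (⊤ : (Spec (CommRingCat.of (MvPolynomial σ ℂ))).Opens) ≤
      Spec.map (CommRingCat.ofHom (awayAeval hφ)) ⁻¹ᵁ ⊤ := le_top
  have hiso : IsIso (a.appLE U ⊤ h₁) := by
    have := a.isIso_app U hU.le
    have : IsIso (homOfLE h₁) := ⟨homOfLE htop.le, rfl, rfl⟩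
    rw [Scheme.Hom.appLE]
    infer_instance
  have hfac : (affineImmersion hl hφ).appLE U ⊤ (top_le_affineImmersion_preimage hl hφ) =
      a.appLE U ⊤ h₁ ≫ (Spec.map (CommRingCat.ofHom (awayAeval hφ))).appLE ⊤ ⊤ h₂ :=
    (Scheme.Hom.appLE_comp_appLE _ _ _ _ _ h₁ h₂).symm
  have hspec : Function.Surjective
      ((Spec.map (CommRingCat.ofHom (awayAeval hφ))).appLE ⊤ ⊤ h₂) := by
    have h : (Spec.map (CommRingCat.ofHom (awayAeval hφ))).appLE ⊤ ⊤ h₂ =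
        (Scheme.ΓSpecIso _).hom ≫ CommRingCat.ofHom (awayAeval hφ) ≫
          (Scheme.ΓSpecIso _).inv := by
      rw [← Category.assoc, ← Scheme.ΓSpecIso_naturality, Category.assoc, Iso.hom_inv_id,
        Category.comp_id]
      exact Scheme.Hom.appLE_eq_app _
    rw [h]
    exact ((ConcreteCategory.bijective_of_isIso (Scheme.ΓSpecIso _).inv).surjective.comp
      (awayAeval_surjective hl hφ hsurj)).comp
      (ConcreteCategory.bijective_of_isIso (Scheme.ΓSpecIso _).hom).surjective
  rw [hfac]
  exact hspec.comp (ConcreteCategory.bijective_of_isIso (a.appLE U ⊤ h₁)).surjective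

end Immersion

/-! ### Reduced closed subschemes covered by affine spaces -/

section ReducedSubscheme

open MvPolynomial TopologicalSpace CategoryTheory

/-- Affine space is standard smooth, presented by the variables without relations. -/
theorem isStandardSmoothOfRelativeDimension_C (R σ : Type) [CommRing R] [Fintype σ] :
    RingHom.IsStandardSmoothOfRelativeDimension (Fintype.card σ) (C : R →+* MvPolynomial σ R) := by
  have hid : (aeval X : MvPolynomial σ R →ₐ[R] MvPolynomial σ R) = AlgHom.id R _ := by
    ext
    simp
  let G : Algebra.Generators R (MvPolynomial σ R) σ :=
    { val := X
      σ' := id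
      aeval_val_σ' := fun s ↦ by rw [hid]; rfl }
  let P : Algebra.PreSubmersivePresentation R (MvPolynomial σ R) σ PEmpty.{1} :=
    { toGenerators := G
      relation := PEmpty.elim
      span_range_relation_eq_ker := by
        rw [Set.range_eq_empty, Ideal.span_empty, eq_comm]
        refine (RingHom.injective_iff_ker_eq_bot _).1 ?_
        change Function.Injective (aeval X : MvPolynomial σ R →ₐ[R] MvPolynomial σ R)
        rw [hid]
        exact Function.injective_id
      map := PEmpty.elim
      map_inj := fun x ↦ x.elim }
  let Q : Algebra.SubmersivePresentation R (MvPolynomial σ R) σ PEmpty.{1} :=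
    { toPreSubmersivePresentation := P
      jacobian_isUnit := by
        classical
        rw [P.jacobian_eq_jacobiMatrix_det, Matrix.det_isEmpty, map_one]
        exact isUnit_one }
  have h : Algebra.IsStandardSmoothOfRelativeDimension (Fintype.card σ) R (MvPolynomial σ R) :=
    Q.isStandardSmoothOfRelativeDimension (by simp [Algebra.Presentation.dimension])
  exact (RingHom.isStandardSmoothOfRelativeDimension_algebraMap _).2 h

/-- The ideal of the reduced closure of `T` on an affine open set consists of the functions that
vanish at the points of `T`. -/
theorem mem_vanishingIdeal_closure_iff {Y : Scheme.{0}} (T : Set Y) (U : Y.affineOpens)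
    (s : Γ(Y, U)) :
    s ∈ (Scheme.IdealSheafData.vanishingIdeal (Closeds.closure T)).ideal U ↔
      ∀ x ∈ T, x ∉ Y.basicOpen s := by
  rw [Scheme.IdealSheafData.vanishingIdeal_ideal, PrimeSpectrum.mem_vanishingIdeal]
  have hpt : ∀ p : Spec Γ(Y, U), U.2.fromSpec p ∈ Y.basicOpen s ↔ s ∉ p.asIdeal := fun p ↦
    iff_of_eq (congrArg (p ∈ ·) (U.2.fromSpec_preimage_basicOpen s))
  constructor
  · intro h x hx hxs
    obtain ⟨p, rfl⟩ : x ∈ Set.range U.2.fromSpec := by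
      rw [U.2.range_fromSpec]
      exact Y.basicOpen_le s hxs
    exact (hpt p).1 hxs (h p (subset_closure hx))
  · intro h p hp
    by_contra hps
    obtain ⟨x, hxU, hxT⟩ := mem_closure_iff.1 hp (Y.basicOpen s) (Y.basicOpen s).isOpen
      ((hpt p).2 hps)
    exact h x hxT hxU

instance isReduced_vanishingIdeal_subscheme {Y : Scheme.{0}} (Z : Closeds Y) :
    IsReduced (Scheme.IdealSheafData.vanishingIdeal Z).subscheme := by
  have hred : ∀ U : Y.affineOpens,
      _root_.IsReduced (Γ(Y, U) ⧸ (Scheme.IdealSheafData.vanishingIdeal Z).ideal U) := by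
    intro U
    rw [← Ideal.isRadical_iff_quotient_reduced, Scheme.IdealSheafData.vanishingIdeal_ideal]
    exact PrimeSpectrum.isRadical_vanishingIdeal _
  refine @IsReduced.of_openCover _
    (Scheme.IdealSheafData.vanishingIdeal Z).subschemeCover.openCover fun U ↦ ?_
  have := hred U
  exact inferInstanceAs (IsReduced
    (Spec (.of (Γ(Y, U.1) ⧸ (Scheme.IdealSheafData.vanishingIdeal Z).ideal U))))

/-- If the trace of the closure of `T` on an affine open set `U` is the closed image of an affine
space, then the reduced closed subscheme on the closure of `T` is standard smooth there. -/
theorem isStandardSmooth_of_affineSpace {σ : Type} [Fintype σ] {Y : Scheme.{0}}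
    (f : Y ⟶ Spec (CommRingCat.of ℂ)) (T : Set Y) (U : Y.affineOpens)
    (j : Spec (CommRingCat.of (MvPolynomial σ ℂ)) ⟶ Y) (hj : ⊤ ≤ j ⁻¹ᵁ U)
    (hjf : j ≫ f = Spec.map (CommRingCat.ofHom (C : ℂ →+* MvPolynomial σ ℂ)))
    (hsurj : Function.Surjective (j.appLE U ⊤ hj))
    (hjT : ∀ y, j (affinePoint y) ∈ T)
    (hTj : ∀ x ∈ T, x ∈ (U : Y.Opens) → ∃ y, j (affinePoint y) = x)
    (hV : (Scheme.IdealSheafData.vanishingIdeal (Closeds.closure T)).subschemeι ⁻¹ᵁ U ≤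
      ((Scheme.IdealSheafData.vanishingIdeal (Closeds.closure T)).subschemeι ≫ f) ⁻¹ᵁ ⊤) :
    RingHom.IsStandardSmoothOfRelativeDimension (Fintype.card σ)
      (((Scheme.IdealSheafData.vanishingIdeal (Closeds.closure T)).subschemeι ≫ f).appLE ⊤
        ((Scheme.IdealSheafData.vanishingIdeal (Closeds.closure T)).subschemeι ⁻¹ᵁ U)
        hV).hom := by
  set I := Scheme.IdealSheafData.vanishingIdeal (Closeds.closure T) with hI
  -- Both kernels consist of the functions that vanish at the points of `T`.
  have hker : RingHom.ker (j.appLE U ⊤ hj).hom = RingHom.ker (I.subschemeι.app U).hom := by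
    rw [Scheme.IdealSheafData.ker_subschemeι_app]
    ext s
    rw [hI, mem_vanishingIdeal_closure_iff, RingHom.mem_ker]
    have hpt : ∀ y, j (affinePoint y) ∈ Y.basicOpen s ↔
        eval y ((Scheme.ΓSpecIso _).hom (j.appLE U ⊤ hj s)) ≠ 0 := by
      intro y
      have h : (Spec (CommRingCat.of (MvPolynomial σ ℂ))).basicOpen (j.appLE U ⊤ hj s) =
          j ⁻¹ᵁ Y.basicOpen s := by
        rw [Scheme.Hom.appLE, CommRingCat.comp_apply, Scheme.basicOpen_res, top_inf_eq,
          Scheme.Hom.preimage_basicOpen]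
      rw [basicOpen_eq_of_affine'] at h
      exact (iff_of_eq (congrArg (affinePoint y ∈ ·) h)).symm
    constructor
    · intro h x hx hxs
      obtain ⟨y, rfl⟩ := hTj x hx (Y.basicOpen_le s hxs)
      refine (hpt y).1 hxs ?_
      change eval y ((Scheme.ΓSpecIso _).hom ((j.appLE U ⊤ hj).hom s)) = 0
      rw [h, map_zero, map_zero]
    · intro h
      have h0 : (Scheme.ΓSpecIso _).hom (j.appLE U ⊤ hj s) = 0 :=
        MvPolynomial.funext fun y ↦ by
          rw [map_zero]
          exact not_not.1 fun hy ↦ h _ (hjT y) ((hpt y).2 hy)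
      exact (Scheme.ΓSpecIso
        (CommRingCat.of (MvPolynomial σ ℂ))).commRingCatIsoToRingEquiv.injective
          (h0.trans (map_zero _).symm)
  let E : MvPolynomial σ ℂ ≃+* Γ(I.subscheme, I.subschemeι ⁻¹ᵁ U) :=
    ((Scheme.ΓSpecIso (CommRingCat.of (MvPolynomial σ ℂ))).commRingCatIsoToRingEquiv.symm.trans
      (RingHom.quotientKerEquivOfSurjective (f := (j.appLE U ⊤ hj).hom) hsurj).symm).trans
      ((Ideal.quotEquivOfEq hker).trans
        (RingHom.quotientKerEquivOfSurjective (f := (I.subschemeι.app U).hom)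
          (I.subschemeι_app_surjective U)))
  have hE : ∀ s, E ((Scheme.ΓSpecIso _).hom (j.appLE U ⊤ hj s)) = I.subschemeι.app U s := by
    intro s
    have h₁ : (Scheme.ΓSpecIso (CommRingCat.of (MvPolynomial σ ℂ))).commRingCatIsoToRingEquiv.symm
        ((Scheme.ΓSpecIso _).hom (j.appLE U ⊤ hj s)) = j.appLE U ⊤ hj s :=
      RingEquiv.symm_apply_apply _ _
    have h₂ : (RingHom.quotientKerEquivOfSurjective (f := (j.appLE U ⊤ hj).hom) hsurj).symm
        (j.appLE U ⊤ hj s) = Ideal.Quotient.mk _ s := (RingEquiv.symm_apply_eq _).2 rfl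
    simp only [E, RingEquiv.trans_apply]
    rw [h₁, h₂]
    rfl
  have hcomp : ((I.subschemeι ≫ f).appLE ⊤ (I.subschemeι ⁻¹ᵁ U) hV).hom =
      (E : MvPolynomial σ ℂ →+* Γ(I.subscheme, I.subschemeι ⁻¹ᵁ U)).comp
        ((C : ℂ →+* MvPolynomial σ ℂ).comp
          ((Scheme.ΓSpecIso (CommRingCat.of ℂ)).commRingCatIsoToRingEquiv :
            Γ(Spec (CommRingCat.of ℂ), ⊤) →+* ℂ)) := by
    ext a
    have hfU : (U : Y.Opens) ≤ f ⁻¹ᵁ ⊤ := le_top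
    have h₁ : (I.subschemeι ≫ f).appLE ⊤ (I.subschemeι ⁻¹ᵁ U) hV =
        f.appLE ⊤ U hfU ≫ I.subschemeι.app U := by
      rw [Scheme.Hom.app_eq_appLE, Scheme.Hom.appLE_comp_appLE]
    have h₂ : f.appLE ⊤ U hfU ≫ j.appLE U ⊤ hj ≫ (Scheme.ΓSpecIso _).hom =
        (Scheme.ΓSpecIso (CommRingCat.of ℂ)).hom ≫
          CommRingCat.ofHom (C : ℂ →+* MvPolynomial σ ℂ) := by
      rw [← Scheme.ΓSpecIso_naturality, Scheme.Hom.appLE_comp_appLE_assoc]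
      simp only [hjf]
      congr 1
    rw [h₁]
    refine (hE _).symm.trans (congrArg E ?_)
    exact congrArg (fun g ↦ g.hom a) h₂
  rw [hcomp]
  have h := (RingHom.IsStandardSmoothOfRelativeDimension.equiv E).comp
    ((isStandardSmoothOfRelativeDimension_C ℂ σ).comp
      (RingHom.IsStandardSmoothOfRelativeDimension.equiv
        (Scheme.ΓSpecIso (CommRingCat.of ℂ)).commRingCatIsoToRingEquiv))
  rwa [zero_add, add_zero] at h

end ReducedSubscheme

/-! ### The restrictive flag manifold -/

section Main

open MvPolynomial TopologicalSpace CategoryTheory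

variable {n s : ℕ} {k : Fin s → ℕ} {P : Fin s → Submodule ℂ (Fin n → ℂ)}

theorem complexPoint_mem_flagLocus_iff (p : ℙ ℂ (PluckerIndex n k → ℂ)) :
    complexPoint p ∈ flagLocus k P ↔ ∃ F : RestrictiveFlag k P, F.plucker = p := by
  constructor
  · intro h
    have h' : complexPoint p ∈
        closure (complexPoint '' Set.range (RestrictiveFlag.plucker (k := k) (P := P))) := by
      rw [← Set.range_comp]
      exact h
    obtain ⟨F, hF⟩ := exists_flag_of_forall_eval_eq_zero (P := P) p.rep_nonzero
      fun d f hf hflag ↦ (mem_complexPoint_iff hf p).1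
        (mem_of_mem_closure_complexPoint h' hf (by
          rintro _ ⟨F, rfl⟩
          exact (eval_rep_eq_zero_iff hf _).2 (hflag F)))
    exact ⟨F, hF.trans p.mk_rep⟩
  · rintro ⟨F, rfl⟩
    exact subset_closure ⟨F, rfl⟩

theorem joinedByCurves_range_plucker (hk : Monotone k) :
    JoinedByCurves (Set.range (RestrictiveFlag.plucker (k := k) (P := P))) := by
  rintro _ ⟨F, rfl⟩ _ ⟨G, rfl⟩
  obtain ⟨γ, h0, h1, h⟩ := F.exists_curve hk G
  exact ⟨γ, h0, h1, h⟩

theorem irreducibleSpace_restrictiveFlagManifold (hk : Monotone k) (hP : Monotone P)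
    (hkP : ∀ i, k i ≤ Module.finrank ℂ (P i)) :
    IrreducibleSpace (restrictiveFlagManifold k P) := by
  obtain ⟨F⟩ := nonempty_restrictiveFlag hk hP hkP
  have hrange : Set.range (restrictiveFlagManifold.ι k P) = flagLocus k P :=
    (Scheme.IdealSheafData.range_subschemeι _).trans
      (Scheme.IdealSheafData.coe_support_vanishingIdeal _)
  have hirr : IsIrreducible (flagLocus k P : Set (ProjSpace (PluckerIndex n k))) := by
    refine ⟨⟨_, subset_closure ⟨F, rfl⟩⟩, ?_⟩
    have h := (joinedByCurves_range_plucker (P := P) hk).isPreirreducible.closure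
    rw [← Set.range_comp] at h
    exact h
  have hemb : Topology.IsEmbedding (restrictiveFlagManifold.ι k P) :=
    (Scheme.IdealSheafData.vanishingIdeal (flagLocus k P)).subschemeι.isEmbedding
  have hmem (x : restrictiveFlagManifold k P) :
      restrictiveFlagManifold.ι k P x ∈ (flagLocus k P : Set (ProjSpace (PluckerIndex n k))) :=
    hrange ▸ ⟨x, rfl⟩
  rw [irreducibleSpace_def]
  constructor
  · obtain ⟨z, hz⟩ := hirr.1
    rw [← hrange] at hz
    obtain ⟨x, -⟩ := hz
    exact ⟨x, trivial⟩
  · rintro u v hu hv ⟨x, -, hxu⟩ ⟨y, -, hyv⟩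
    obtain ⟨u', hu', rfl⟩ := hemb.isInducing.isOpen_iff.1 hu
    obtain ⟨v', hv', rfl⟩ := hemb.isInducing.isOpen_iff.1 hv
    obtain ⟨z, hz, hzu, hzv⟩ :=
      hirr.2 u' v' hu' hv' ⟨_, hmem x, hxu⟩ ⟨_, hmem y, hyv⟩
    rw [← hrange] at hz
    obtain ⟨w, rfl⟩ := hz
    exact ⟨w, trivial, hzu, hzv⟩

/-- The charts cover: a point of the locus specializes to a complex point of it, which is a
flag, and lies in any chart around that flag. -/
theorem exists_chart_of_mem_flagLocus (hk_pos : ∀ i, 0 < k i) (hk : StrictMono k)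
    (hP : Monotone P) {x : ProjSpace (PluckerIndex n k)} (hx : x ∈ flagLocus k P) :
    ∃ (l : MvPolynomial (PluckerIndex n k) ℂ)
      (φ : PluckerIndex n k → MvPolynomial (ChartIndex k P) ℂ)
      (hl : l ∈ homogeneousSubmodule (PluckerIndex n k) ℂ 1) (hφ : aeval φ l = 1),
      x ∈ Proj.basicOpen (homogeneousSubmodule (PluckerIndex n k) ℂ) l ∧
      Function.Surjective (aeval (R := ℂ) φ) ∧
      (∀ y, ∃ F : RestrictiveFlag k P,
        complexPoint F.plucker = affineImmersion hl hφ (affinePoint y)) ∧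
      ∀ F : RestrictiveFlag k P, complexPoint F.plucker ∈
        Proj.basicOpen (homogeneousSubmodule (PluckerIndex n k) ℂ) l →
        ∃ y, affineImmersion hl hφ (affinePoint y) = complexPoint F.plucker := by
  obtain ⟨p, hp⟩ := exists_complexPoint_specialization x
  have hpZ : complexPoint p ∈ flagLocus k P :=
    closure_minimal (Set.singleton_subset_iff.2 hx) (flagLocus k P).isClosed hp
  obtain ⟨F, rfl⟩ := (complexPoint_mem_flagLocus_iff p).1 hpZ
  obtain ⟨l, φ, hl, hφ, hsurj, hFl, hflag, hchart⟩ := F.exists_chart hk_pos hk hP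
  refine ⟨l, φ, hl, hφ, ?_, hsurj, fun y ↦ ?_, fun G hG ↦ ?_⟩
  · have hmem : complexPoint F.plucker ∈
        Proj.basicOpen (homogeneousSubmodule (PluckerIndex n k) ℂ) l :=
      fun h ↦ hFl ((mem_complexPoint_mk_iff hl _).1 h)
    exact (specializes_iff_mem_closure.2 hp).mem_open (Proj.basicOpen _ l).isOpen hmem
  · obtain ⟨G, hy, hG⟩ := hflag y
    exact ⟨G, (congrArg complexPoint hG).trans (affineImmersion_affinePoint _ hφ y hy).symm⟩
  · obtain ⟨y, hy, hGy⟩ := hchart G fun h ↦ hG ((mem_complexPoint_mk_iff hl _).2 h)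
    exact ⟨y, (affineImmersion_affinePoint _ hφ y hy).trans (congrArg complexPoint hGy).symm⟩

theorem smoothOfRelativeDimension_restrictiveFlagManifold (hk_pos : ∀ i, 0 < k i)
    (hk : StrictMono k) (hP : Monotone P) :
    SmoothOfRelativeDimension
      (∑ i, (k i - prevDim k i) * (Module.finrank ℂ (P i) - k i))
      (restrictiveFlagManifold.ι k P ≫ ProjSpace.toSpec (PluckerIndex n k)) := by
  refine ⟨fun x ↦ ?_⟩
  have hx : restrictiveFlagManifold.ι k P x ∈ flagLocus k P := by
    have h : restrictiveFlagManifold.ι k P x ∈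
        Set.range (Scheme.IdealSheafData.vanishingIdeal (flagLocus k P)).subschemeι := ⟨x, rfl⟩
    rwa [Scheme.IdealSheafData.range_subschemeι,
      Scheme.IdealSheafData.coe_support_vanishingIdeal] at h
  obtain ⟨l, φ, hl, hφ, hxl, hsurj, hflag, hchart⟩ :=
    exists_chart_of_mem_flagLocus hk_pos hk hP hx
  let U : (ProjSpace (PluckerIndex n k)).affineOpens :=
    ⟨Proj.basicOpen _ l, Proj.isAffineOpen_basicOpen _ l hl one_pos⟩
  have hV : IsAffineOpen (restrictiveFlagManifold.ι k P ⁻¹ᵁ U) :=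
    U.2.preimage (Scheme.IdealSheafData.vanishingIdeal (flagLocus k P)).subschemeι
  refine ⟨⊤, isAffineOpen_top _, _, hV, hxl, le_top, ?_⟩
  rw [← card_chartIndex]
  refine isStandardSmooth_of_affineSpace (ProjSpace.toSpec _) _ U (affineImmersion hl hφ)
    (top_le_affineImmersion_preimage hl hφ) (affineImmersion_toSpec hl hφ)
    (affineImmersion_appLE_surjective hl hφ hsurj) hflag ?_ _
  rintro _ ⟨G, rfl⟩ hG
  exact hchart G hG

end Main

theorem lemma2p1p9 {n s : ℕ} (k : Fin s → ℕ) (P : Fin s → Submodule ℂ (Fin n → ℂ))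
    (hP : Monotone P) (hk_pos : ∀ i, 0 < k i) (hk : StrictMono k)
    (hkP : ∀ i, k i ≤ Module.finrank ℂ (P i)) :
    -- the complex points are exactly the restrictive flags
    Function.Injective (RestrictiveFlag.plucker (k := k) (P := P)) ∧
    (∀ p : ℙ ℂ (PluckerIndex n k → ℂ),
      complexPoint p ∈ flagLocus k P ↔ ∃ F : RestrictiveFlag k P, F.plucker = p) ∧
    -- projective
    IsClosedImmersion (restrictiveFlagManifold.ι k P) ∧
    -- a variety, connected in the Zariski topology and in the classical one
    AlgebraicGeometry.IsIntegral (restrictiveFlagManifold k P) ∧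
    ConnectedSpace (restrictiveFlagManifold k P) ∧
    @IsConnected _ (classicalTopology (PluckerIndex n k))
      (Set.range (RestrictiveFlag.plucker (k := k) (P := P))) ∧
    -- smooth over the complex numbers, of the stated dimension
    SmoothOfRelativeDimension
      (∑ i, (k i - prevDim k i) * (Module.finrank ℂ (P i) - k i))
      (restrictiveFlagManifold.ι k P ≫ ProjSpace.toSpec (PluckerIndex n k)) := by
  have hirr := irreducibleSpace_restrictiveFlagManifold hk.monotone hP hkP
  have hred : IsReduced (restrictiveFlagManifold k P) := isReduced_vanishingIdeal_subscheme _
  obtain ⟨F⟩ := nonempty_restrictiveFlag hk.monotone hP hkP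
  refine ⟨RestrictiveFlag.plucker_injective, complexPoint_mem_flagLocus_iff, ?_,
    isIntegral_of_irreducibleSpace_of_isReduced _, inferInstance,
    ⟨⟨_, F, rfl⟩, (joinedByCurves_range_plucker hk.monotone).isPreconnected_classical⟩,
    smoothOfRelativeDimension_restrictiveFlagManifold hk_pos hk hP⟩
  exact inferInstanceAs (IsClosedImmersion
    (Scheme.IdealSheafData.vanishingIdeal (flagLocus k P)).subschemeι)
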